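/- **Setting.** Let $\mathcal H$ be a separable complex Hilbert space and let $\Xi$ be the real vector space of self-adjoint trace-class operators of trace $0$ on $\mathcal H$, with the Hilbert–Schmidt inner product $(\phi,\chi)_\Xi=\operatorname{Tr}[\phi^*\chi]$; let $\overline\Xi$ be its Hilbert space completion (equal to $\Xi$ if $\dim\mathcal H<\infty$). Fix a density operator $\rho_0$, put $\rho(\theta)=\rho_0+\theta$ for $\theta\in\Xi$, and let $\theta\in\Theta=\{\theta'\in\Xi:\rho_0+\theta'>0\}$ (strictly positive). **Measurement.** Let $M$ be a POVM on a measurable space $(\Omega,\mathfrak B)$ and $P_{\theta'}(E)=\operatorname{Tr}[\rho(\theta')M(E)]$. Suppose that for every $E\in\mathfrak B$ the function $\theta'\mapsto P_{\theta'}(E)$ on $\Xi$ is Fréchet differentiable at $\theta$ and that there is $\kappa\in L^2(\Omega,P_\theta;\overline\Xi)$ (the logarithmic gradient) with $$D_\theta P_\theta(E)[\phi]=\int_E(\kappa(x),\phi)\,P_\theta(dx)\qquad(E\in\mathfrak B,\ \phi\in\Xi).$$ The Fisher information operator is $J^M_\theta=\mathbb E_\theta[\kappa\kappa^*]$, that is,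 $J^M_\theta\chi=\int(\kappa(x),\chi)\,\kappa(x)\,P_\theta(dx)$ on $\overline\Xi$. Let $(J^M_\theta)^+$ be a Moore–Penrose inverse of $J=J^M_\theta$, i.e. a linear operator, possibly unbounded, whose domain contains the range of $J$, with $JJ^+J=J$, $J^+JJ^+=J^+$, and with $JJ^+$ and $J^+J$ symmetric. **Observables.** For a densely defined operator $X$ write $X\in\tilde{\mathcal O}$ if $\rho(\theta)X$ extends to a trace-class operator, and then $\langle X\rangle_\theta=\operatorname{Tr}[\rho(\theta)X]$ denotes the trace of that extension; similarly for the other values of the parameter. Let $A,B$ be (possibly unbounded) self-adjoint operators with $A,B,A^2,B^2,AB\in\tilde{\mathcal O}$, such that $\theta'\mapsto\langle A\rangle_{\theta'}$ and $\theta'\mapsto\langle B\rangle_{\theta'}$ have gradients $\nabla_\theta\langle A\rangle_\theta,\nabla_\theta\langle B\rangle_\theta\in\overline\Xi$ at $\theta$ (Fréchet derivatives along the set of $\theta'\in\Xi$ at which the expectation value is finite) that lie in the domain of $(J^M_\theta)^+$. Put $$C_\theta(A,B)=\langle AB\rangle_\theta-\langle A\rangle_\theta\langle B\rangle_\theta,\quad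 C^{\mathrm S}_\theta(A,B)=\tfrac12\{C_\theta(A,B)+C_\theta(B,A)\},\quad \sigma^2_\theta(A)=C_\theta(A,A),$$ $$\varepsilon(A;\rho(\theta),M)=\begin{cases}\big(\nabla_\theta\langle A\rangle_\theta,(J^M_\theta)^+\nabla_\theta\langle A\rangle_\theta\big)-\sigma_\theta^2(A)&\text{if }\nabla_\theta\langle A\rangle_\theta\in(\ker J^M_\theta)^\perp,\\+\infty&\text{otherwise,}\end{cases}$$ and likewise for $B$. **Theorem.** Under these assumptions $$\varepsilon(A;\rho(\theta),M)\,\varepsilon(B;\rho(\theta),M)\ \ge\ \mathcal R^M(A,B)^2+\tfrac14\big|\langle[A,B]\rangle_\theta\big|^2,$$ where $\mathcal R^M(A,B)=\big(\nabla_\theta\langle A\rangle_\theta,(J^M_\theta)^+\nabla_\theta\langle B\rangle_\theta\big)-C^{\mathrm S}_\theta(A,B)$ and $[A,B]=AB-BA$. A product with a factor $+\infty$ is read as $+\infty$ (also $0\cdot\infty=\infty$). -/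

import Mathlib

open MeasureTheory Set
open scoped ENNReal ComplexOrder InnerProductSpace InnerProduct

noncomputable section

namespace QuantumEstimation

universe u

section TraceClass

variable {H : Type u} [NormedAddCommGroup H] [InnerProductSpace ℂ H] [CompleteSpace H]

/-- The index set of a fixed Hilbert basis of `H`. -/
def basisIndex (H : Type u) [NormedAddCommGroup H] [InnerProductSpace ℂ H] [CompleteSpace H] :
    Set H :=
  (exists_hilbertBasis ℂ H).choose

/-- A fixed Hilbert basis (complete orthonormal system) of `H`. -/
def stdBasis (H : Type u) [NormedAddCommGroup H] [InnerProductSpace ℂ H] [CompleteSpace H] :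
    HilbertBasis (basisIndex H) ℂ H :=
  (exists_hilbertBasis ℂ H).choose_spec.choose

/-- `T` is of trace class: `Tr √(T* T) = ∑ᵢ ⟨eᵢ, |T| eᵢ⟩ < ∞`. -/
def IsTraceClass (T : H →L[ℂ] H) : Prop :=
  Summable fun i => (⟪stdBasis H i, CFC.abs T (stdBasis H i)⟫_ℂ).re

/-- The trace `Tr T = ∑ᵢ ⟨eᵢ, T eᵢ⟩`, meaningful for trace-class `T`. -/
def trace (T : H →L[ℂ] H) : ℂ :=
  ∑' i, ⟪stdBasis H i, T (stdBasis H i)⟫_ℂ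

/-- Auxiliary: `T = ∑ₙ |xₙ⟩⟨yₙ|` with square-summable `‖xₙ‖`, `‖yₙ‖`. -/
def HasFactor {ι : Type u} (T : H →L[ℂ] H) (x y : ι → H) : Prop :=
  (Summable fun n => ‖x n‖ ^ 2) ∧ (Summable fun n => ‖y n‖ ^ 2) ∧
    ∀ v w : H, HasSum (fun n => ⟪v, x n⟫_ℂ * ⟪y n, w⟫_ℂ) ⟪v, T w⟫_ℂ

lemma parseval {H : Type u} [NormedAddCommGroup H] [InnerProductSpace ℂ H] {ι : Type u} (b : HilbertBasis ι ℂ H) (x : H) :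
    HasSum (fun i => ‖⟪b i, x⟫_ℂ‖ ^ 2) (‖x‖ ^ 2) := by
  have h := b.hasSum_inner_mul_inner x x
  have h2 := Complex.hasSum_re h
  have e : (⟪x, x⟫_ℂ).re = ‖x‖ ^ 2 := by
    simpa using inner_self_eq_norm_sq (𝕜 := ℂ) x
  rw [e] at h2
  convert h2 using 2 with i
  rw [← inner_conj_symm x (b i), mul_comm, Complex.mul_conj, Complex.normSq_eq_norm_sq,
    Complex.ofReal_re]

lemma HasFactor.hasSum_trace {ι κ : Type u} {T : H →L[ℂ] H} {x y : ι → H} (h : HasFactor T x y)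
    (b : HilbertBasis κ ℂ H) :
    HasSum (fun i => ⟪b i, T (b i)⟫_ℂ) (∑' n, ⟪y n, x n⟫_ℂ) := by
  obtain ⟨hx, hy, hT⟩ := h
  have key : ∀ z : ι → H, (Summable fun n => ‖z n‖ ^ 2) →
      Summable fun p : ι × κ => ‖⟪b p.2, z p.1⟫_ℂ‖ ^ 2 := by
    intro z hz
    rw [summable_prod_of_nonneg (fun _ => by positivity)]
    refine ⟨fun n => (parseval b (z n)).summable, ?_⟩
    simpa only [(parseval b (z _)).tsum_eq] using hz
  have hs : Summable fun p : ι × κ => ⟪b p.2, x p.1⟫_ℂ * ⟪y p.1, b p.2⟫_ℂ := by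
    refine Summable.of_norm_bounded ((key x hx).add (key y hy)) fun p => ?_
    rw [norm_mul, norm_inner_symm (y p.1)]
    nlinarith [sq_nonneg (‖⟪b p.2, x p.1⟫_ℂ‖ - ‖⟪b p.2, y p.1⟫_ℂ‖),
      sq_nonneg (‖⟪b p.2, x p.1⟫_ℂ‖), sq_nonneg (‖⟪b p.2, y p.1⟫_ℂ‖)]
  have h1 : ∀ n, HasSum (fun i => ⟪b i, x n⟫_ℂ * ⟪y n, b i⟫_ℂ) ⟪y n, x n⟫_ℂ := fun n => by
    simpa only [mul_comm] using b.hasSum_inner_mul_inner (y n) (x n)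
  have h2 := hs.hasSum.prod_fiberwise h1
  have h3 : HasSum (fun q : κ × ι => ⟪b q.1, x q.2⟫_ℂ * ⟪y q.2, b q.1⟫_ℂ)
      (∑' p : ι × κ, ⟪b p.2, x p.1⟫_ℂ * ⟪y p.1, b p.2⟫_ℂ) :=
    (Equiv.prodComm κ ι).hasSum_iff.mpr hs.hasSum
  rw [h2.tsum_eq]
  exact h3.prod_fiberwise fun i => hT (b i) (b i)

lemma HasFactor.mul_left {ι : Type u} {T : H →L[ℂ] H} {x y : ι → H} (h : HasFactor T x y)
    (B : H →L[ℂ] H) : HasFactor (B * T) (fun n => B (x n)) y := by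
  obtain ⟨hx, hy, hT⟩ := h
  refine ⟨?_, hy, fun v w => ?_⟩
  · refine Summable.of_nonneg_of_le (fun _ => by positivity) (fun n => ?_) (hx.mul_left (‖B‖ ^ 2))
    rw [← mul_pow]
    exact pow_le_pow_left₀ (norm_nonneg _) (B.le_opNorm _) 2
  · simpa [← ContinuousLinearMap.adjoint_inner_left] using hT ((B†) v) w

lemma HasFactor.mul_right {ι : Type u} {T : H →L[ℂ] H} {x y : ι → H} (h : HasFactor T x y)
    (B : H →L[ℂ] H) : HasFactor (T * B) x (fun n => (B†) (y n)) := by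
  obtain ⟨hx, hy, hT⟩ := h
  refine ⟨hx, ?_, fun v w => ?_⟩
  · refine Summable.of_nonneg_of_le (fun _ => by positivity) (fun n => ?_)
      (hy.mul_left (‖B†‖ ^ 2))
    rw [← mul_pow]
    exact pow_le_pow_left₀ (norm_nonneg _) ((B†).le_opNorm _) 2
  · simpa [ContinuousLinearMap.adjoint_inner_left] using hT v (B w)

lemma abs_sq_inner (T : H →L[ℂ] H) (v w : H) :
    ⟪CFC.abs T v, CFC.abs T w⟫_ℂ = ⟪T v, T w⟫_ℂ := by
  have h := CFC.abs_mul_abs T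
  have hs : IsSelfAdjoint (CFC.abs T) := (CFC.abs_nonneg T).isSelfAdjoint
  rw [← ContinuousLinearMap.adjoint_inner_right, ← ContinuousLinearMap.adjoint_inner_right T,
    ← ContinuousLinearMap.star_eq_adjoint, ← ContinuousLinearMap.star_eq_adjoint, hs.star_eq]
  have := congrArg (fun S : H →L[ℂ] H => ⟪v, S w⟫_ℂ) h
  simpa using this

lemma norm_abs_apply (T : H →L[ℂ] H) (v : H) : ‖CFC.abs T v‖ = ‖T v‖ := by
  have h := abs_sq_inner T v v
  rw [inner_self_eq_norm_sq_to_K, inner_self_eq_norm_sq_to_K] at h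
  have h' : ‖CFC.abs T v‖ ^ 2 = ‖T v‖ ^ 2 := by exact_mod_cast h
  exact (pow_left_inj₀ (norm_nonneg _) (norm_nonneg _) two_ne_zero).mp h'

lemma exists_polar (T : H →L[ℂ] H) :
    ∃ W : H →L[ℂ] H, T = W * CFC.abs T ∧ CFC.abs T = (W†) * T := by
  set P := CFC.abs T with hP
  let K : Submodule ℂ H := (LinearMap.range P.toLinearMap).topologicalClosure
  have hmem : ∀ v, P v ∈ K := fun v => Submodule.le_topologicalClosure _ ⟨v, rfl⟩
  let e : H →ₗ[ℂ] K := P.toLinearMap.codRestrict K hmem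
  have hd : DenseRange e := by
    rw [DenseRange, Subtype.dense_iff]
    intro v hv
    have : ((↑) '' range e : Set H) = (LinearMap.range P.toLinearMap : Set H) := by
      ext z
      simp [e]
    have h2 : v ∈ closure ((↑) '' range e : Set H) := by
      rw [this]
      exact hv
    exact h2
  have : CompleteSpace K :=
    (Submodule.isClosed_topologicalClosure (LinearMap.range P.toLinearMap)).completeSpace_coe
  have hn : ∃ C, ∀ v, ‖T.toLinearMap v‖ ≤ C * ‖e v‖ :=
    ⟨1, fun v => by
      rw [one_mul]
      exact (norm_abs_apply T v).symm.le⟩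
  let V : K →L[ℂ] H := T.toLinearMap.extendOfNorm e
  have hV : ∀ v, V (e v) = T v := T.toLinearMap.extendOfNorm_eq hd hn
  let W : H →L[ℂ] H := V ∘L K.orthogonalProjectionOnto
  have hWP : ∀ v, W (P v) = T v := fun v => by
    have : K.orthogonalProjectionOnto (P v) = e v :=
      K.orthogonalProjectionOnto_mem_subspace_eq_self (e v)
    simp only [W, ContinuousLinearMap.comp_apply, this, hV]
  refine ⟨W, ContinuousLinearMap.ext fun v => (hWP v).symm, ?_⟩
  have hin : ∀ v (k : K), ⟪T v, V k⟫_ℂ = ⟪P v, (k : H)⟫_ℂ := by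
    intro v k
    refine hd.induction_on (p := fun k : K => ⟪T v, V k⟫_ℂ = ⟪P v, (k : H)⟫_ℂ) k ?_ ?_
    · exact isClosed_eq (by fun_prop) (by fun_prop)
    · intro w
      rw [hV]
      exact (abs_sq_inner T v w).symm
  refine ContinuousLinearMap.ext fun v => ext_inner_right ℂ fun w => ?_
  change _ = ⟪(W†) (T v), w⟫_ℂ
  rw [ContinuousLinearMap.adjoint_inner_left]
  simp only [W, ContinuousLinearMap.comp_apply, hin]
  exact (K.inner_orthogonalProjectionOnto_eq_of_mem_left (e v) w).symm

/-- A trace-class operator is a sum of rank-one operators with square-summable factors, and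
conversely. -/
lemma isTraceClass_iff (T : H →L[ℂ] H) :
    IsTraceClass T ↔ ∃ (ι : Type u) (x y : ι → H), HasFactor T x y := by
  obtain ⟨W, hW1, hW2⟩ := exists_polar T
  constructor
  · intro h
    set P := CFC.abs T with hP
    have hP0 : 0 ≤ P := CFC.abs_nonneg T
    set S := CFC.sqrt P with hS
    have hSS : S * S = P := CFC.sqrt_mul_sqrt_self P hP0
    have hSa : S† = S := (CFC.sqrt_nonneg P).isSelfAdjoint.star_eq
    have hsym : ∀ v w, ⟪S v, w⟫_ℂ = ⟪v, S w⟫_ℂ := fun v w => by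
      conv_lhs => rw [← hSa]
      exact ContinuousLinearMap.adjoint_inner_left S w v
    have hsum : Summable fun i => ‖S (stdBasis H i)‖ ^ 2 := by
      refine (summable_congr fun i => ?_).mp h
      rw [← hP, ← hSS]
      change (⟪_, S (S _)⟫_ℂ).re = _
      rw [← hsym]
      simpa using inner_self_eq_norm_sq (𝕜 := ℂ) (S (stdBasis H i))
    refine ⟨basisIndex H, fun i => W (S (stdBasis H i)), fun i => S (stdBasis H i), ?_, hsum, ?_⟩
    · refine Summable.of_nonneg_of_le (fun _ => by positivity) (fun n => ?_)
        (hsum.mul_left (‖W‖ ^ 2))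
      rw [← mul_pow]
      exact pow_le_pow_left₀ (norm_nonneg _) (W.le_opNorm _) 2
    · intro v w
      have := (stdBasis H).hasSum_inner_mul_inner (S ((W†) v)) (S w)
      simp only [hsym, ContinuousLinearMap.adjoint_inner_left] at this
      rw [hW1, ← hSS]
      simpa [← hsym] using this
  · rintro ⟨ι, x, y, h⟩
    have h2 := (h.mul_left (W†)).hasSum_trace (stdBasis H)
    rw [← hW2] at h2
    exact (Complex.hasSum_re h2).summable

lemma IsTraceClass.summable {T : H →L[ℂ] H} (h : IsTraceClass T) :
    Summable fun i => ⟪stdBasis H i, T (stdBasis H i)⟫_ℂ := by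
  obtain ⟨ι, x, y, hf⟩ := (isTraceClass_iff T).mp h
  exact (hf.hasSum_trace _).summable

lemma HasFactor.trace_eq {ι : Type u} {T : H →L[ℂ] H} {x y : ι → H} (h : HasFactor T x y) :
    trace T = ∑' n, ⟪y n, x n⟫_ℂ :=
  (h.hasSum_trace _).tsum_eq

/-- The trace of a trace-class operator does not depend on the Hilbert basis. -/
lemma IsTraceClass.hasSum_trace {T : H →L[ℂ] H} (h : IsTraceClass T) {κ : Type u}
    (b : HilbertBasis κ ℂ H) : HasSum (fun i => ⟪b i, T (b i)⟫_ℂ) (trace T) := by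
  obtain ⟨ι, x, y, hf⟩ := (isTraceClass_iff T).mp h
  rw [hf.trace_eq]
  exact hf.hasSum_trace b

lemma isTraceClass_zero : IsTraceClass (0 : H →L[ℂ] H) := by
  simp [IsTraceClass, summable_zero]

lemma IsTraceClass.add {S T : H →L[ℂ] H} (hS : IsTraceClass S) (hT : IsTraceClass T) :
    IsTraceClass (S + T) := by
  obtain ⟨ι, x, y, hx, hy, hs⟩ := (isTraceClass_iff S).mp hS
  obtain ⟨κ, x', y', hx', hy', ht⟩ := (isTraceClass_iff T).mp hT
  refine (isTraceClass_iff _).mpr ⟨ι ⊕ κ, Sum.elim x x', Sum.elim y y', ?_, ?_, fun v w => ?_⟩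
  · exact (HasSum.sum (f := fun n => ‖Sum.elim x x' n‖ ^ 2) hx.hasSum hx'.hasSum).summable
  · exact (HasSum.sum (f := fun n => ‖Sum.elim y y' n‖ ^ 2) hy.hasSum hy'.hasSum).summable
  · have := HasSum.sum (f := fun n => ⟪v, Sum.elim x x' n⟫_ℂ * ⟪Sum.elim y y' n, w⟫_ℂ)
      (hs v w) (ht v w)
    simpa [inner_add_right] using this

lemma IsTraceClass.mul_left {T : H →L[ℂ] H} (hT : IsTraceClass T) (B : H →L[ℂ] H) :
    IsTraceClass (B * T) := by
  obtain ⟨ι, x, y, h⟩ := (isTraceClass_iff T).mp hT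
  exact (isTraceClass_iff _).mpr ⟨ι, _, _, h.mul_left B⟩

lemma IsTraceClass.mul_right {T : H →L[ℂ] H} (hT : IsTraceClass T) (B : H →L[ℂ] H) :
    IsTraceClass (T * B) := by
  obtain ⟨ι, x, y, h⟩ := (isTraceClass_iff T).mp hT
  exact (isTraceClass_iff _).mpr ⟨ι, _, _, h.mul_right B⟩

lemma IsTraceClass.smul {T : H →L[ℂ] H} (hT : IsTraceClass T) (c : ℝ) :
    IsTraceClass (c • T) := by
  have := hT.mul_left (c • (1 : H →L[ℂ] H))
  simpa using this

lemma trace_add {S T : H →L[ℂ] H} (hS : IsTraceClass S) (hT : IsTraceClass T) :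
    trace (S + T) = trace S + trace T := by
  simp only [trace, add_apply, inner_add_right]
  exact hS.summable.tsum_add hT.summable

lemma trace_smul (c : ℝ) (T : H →L[ℂ] H) : trace (c • T) = (c : ℂ) * trace T := by
  simp only [trace, ← tsum_mul_left]
  refine tsum_congr fun i => ?_
  rw [smul_apply, ← Complex.coe_smul, inner_smul_right]

end TraceClass

section States

variable {H : Type u} [NormedAddCommGroup H] [InnerProductSpace ℂ H] [CompleteSpace H]

/-- Density operators: positive trace-class operators of trace one. -/
structure DensityOperator (H : Type u) [NormedAddCommGroup H] [InnerProductSpace ℂ H]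
    [CompleteSpace H] where
  op : H →L[ℂ] H
  isPositive : op.IsPositive
  isTraceClass : IsTraceClass op
  trace_eq_one : trace op = 1

/-- The real vector space of self-adjoint trace-class operators of trace zero. -/
def tracelessSelfAdjoint (H : Type u) [NormedAddCommGroup H] [InnerProductSpace ℂ H]
    [CompleteSpace H] : Submodule ℝ (H →L[ℂ] H) where
  carrier := {T | IsTraceClass T ∧ IsSelfAdjoint T ∧ trace T = 0}
  add_mem' := by
    rintro S T ⟨hS, hS', hS0⟩ ⟨hT, hT', hT0⟩
    exact ⟨hS.add hT, hS'.add hT', by rw [trace_add hS hT, hS0, hT0, add_zero]⟩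
  zero_mem' := ⟨isTraceClass_zero, IsSelfAdjoint.zero _, by simp [trace]⟩
  smul_mem' := by
    rintro c T ⟨hT, hT', hT0⟩
    exact ⟨hT.smul c, (IsSelfAdjoint.all c).smul hT', by rw [trace_smul, hT0, mul_zero]⟩

/-- The space `Ξ` of self-adjoint trace-class operators of trace zero. It is a type of its own
because it carries the Hilbert-Schmidt norm and not the operator norm. -/
def Xi (H : Type u) [NormedAddCommGroup H] [InnerProductSpace ℂ H] [CompleteSpace H] : Type u :=
  ↥(tracelessSelfAdjoint H)

instance : AddCommGroup (Xi H) := inferInstanceAs (AddCommGroup ↥(tracelessSelfAdjoint H))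

instance : Module ℝ (Xi H) := inferInstanceAs (Module ℝ ↥(tracelessSelfAdjoint H))

/-- The operator underlying an element of `Ξ`. -/
def Xi.op (φ : Xi H) : H →L[ℂ] H := Subtype.val φ

lemma Xi.isTraceClass (φ : Xi H) : IsTraceClass φ.op := φ.2.1

lemma Xi.isSelfAdjoint (φ : Xi H) : IsSelfAdjoint φ.op := φ.2.2.1

lemma Xi.trace_op (φ : Xi H) : trace φ.op = 0 := φ.2.2.2

lemma Xi.inner_op (φ : Xi H) (v w : H) : ⟪φ.op v, w⟫_ℂ = ⟪v, φ.op w⟫_ℂ := by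
  have h : (φ.op)† = φ.op := φ.isSelfAdjoint.star_eq
  conv_lhs => rw [← h]
  exact ContinuousLinearMap.adjoint_inner_left _ _ _

/-- The Hilbert-Schmidt inner product `(φ, χ) = Tr[φ* χ]` on `Ξ`; it is real there. -/
@[reducible]
def xiCore (H : Type u) [NormedAddCommGroup H] [InnerProductSpace ℂ H] [CompleteSpace H] :
    InnerProductSpace.Core ℝ (Xi H) where
  inner φ χ := (trace ((φ.op†) * χ.op)).re
  conj_inner_symm φ χ := by
    have hφ : (φ.op)† = φ.op := φ.isSelfAdjoint.star_eq
    have hχ : (χ.op)† = χ.op := χ.isSelfAdjoint.star_eq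
    simp only [hφ, hχ, conj_trivial]
    rw [trace, trace, Complex.re_tsum (χ.isTraceClass.mul_right φ.op).summable,
      Complex.re_tsum (φ.isTraceClass.mul_right χ.op).summable]
    refine tsum_congr fun i => ?_
    change (⟪_, χ.op (φ.op _)⟫_ℂ).re = (⟪_, φ.op (χ.op _)⟫_ℂ).re
    rw [← Xi.inner_op, ← Xi.inner_op, ← inner_conj_symm, Complex.conj_re]
  re_inner_nonneg φ := by
    have hφ : (φ.op)† = φ.op := φ.isSelfAdjoint.star_eq
    simp only [hφ, RCLike.re_to_real]
    rw [trace, Complex.re_tsum (φ.isTraceClass.mul_right φ.op).summable]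
    refine tsum_nonneg fun i => ?_
    change 0 ≤ (⟪_, φ.op (φ.op _)⟫_ℂ).re
    rw [← Xi.inner_op]
    exact inner_self_nonneg (𝕜 := ℂ)
  add_left φ χ ψ := by
    have e : ((φ + χ).op†) * ψ.op = (φ.op†) * ψ.op + (χ.op†) * ψ.op := by
      change ((φ.op + χ.op)†) * ψ.op = _
      rw [map_add, add_mul]
    rw [e, trace_add (ψ.isTraceClass.mul_left _) (ψ.isTraceClass.mul_left _), Complex.add_re]
  smul_left φ χ r := by
    have e : ((r • φ).op†) * χ.op = r • ((φ.op†) * χ.op) := by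
      have hφ : (φ.op)† = φ.op := φ.isSelfAdjoint.star_eq
      have hr : ((r • φ).op)† = r • φ.op := (r • φ).isSelfAdjoint.star_eq
      rw [hφ, hr, smul_mul_assoc]
    rw [e, trace_smul, Complex.re_ofReal_mul, conj_trivial]
  definite φ h := by
    have hφ : (φ.op)† = φ.op := φ.isSelfAdjoint.star_eq
    simp only [hφ] at h
    have hs := (φ.isTraceClass.mul_right φ.op).summable
    rw [trace, Complex.re_tsum hs] at h
    have e : ∀ i, (⟪stdBasis H i, (φ.op * φ.op) (stdBasis H i)⟫_ℂ).re
        = ‖φ.op (stdBasis H i)‖ ^ 2 := fun i => by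
      change (⟪_, φ.op (φ.op _)⟫_ℂ).re = _
      rw [← Xi.inner_op]
      simpa using inner_self_eq_norm_sq (𝕜 := ℂ) (φ.op (stdBasis H i))
    have hs' := (Complex.hasSum_re hs.hasSum).summable
    simp only [e] at h hs'
    have h0 := (hasSum_zero_iff_of_nonneg (fun i => by positivity)).mp (h ▸ hs'.hasSum)
    have hz : ∀ i, φ.op (stdBasis H i) = 0 := fun i => by
      have := congrFun h0 i
      simpa using this
    refine Subtype.ext (ContinuousLinearMap.ext fun v => ?_)
    change φ.op v = 0
    have hv := ((stdBasis H).hasSum_repr v).mapL φ.op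
    simp only [map_smul, hz, smul_zero] at hv
    exact hv.unique hasSum_zero

instance : NormedAddCommGroup (Xi H) := (xiCore H).toNormedAddCommGroup

instance : InnerProductSpace ℝ (Xi H) := InnerProductSpace.ofCore (xiCore H).toCore

/-- The real Hilbert space of parameters: `Ξ` with the Hilbert-Schmidt inner product, completed.
For finite-dimensional `H` nothing is added. For infinite-dimensional `H` the space `Ξ` is not
complete, and gradients are vectors of its completion. -/
abbrev XiHilbert (H : Type u) [NormedAddCommGroup H] [InnerProductSpace ℂ H] [CompleteSpace H] :
    Type u :=
  UniformSpace.Completion (Xi H)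

/-- The affine family `ρ(θ) = ρ₀ + θ`, `θ ∈ Ξ`. -/
def family (ρ₀ : DensityOperator H) (θ : Xi H) : H →L[ℂ] H := ρ₀.op + θ.op

/-- The parameter space `Θ = {θ ∈ Ξ | ρ₀ + θ > 0}` (strict positivity). -/
def parameterSpace (ρ₀ : DensityOperator H) : Set (Xi H) :=
  {θ | ∀ ψ : H, ψ ≠ 0 → 0 < (⟪ψ, family ρ₀ θ ψ⟫_ℂ).re}

/-- For `θ ∈ Θ` the operator `ρ(θ)` is a density operator. -/
def state (ρ₀ : DensityOperator H) (θ : parameterSpace ρ₀) : DensityOperator H where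
  op := family ρ₀ θ.1
  isPositive := by
    rw [ContinuousLinearMap.isPositive_def']
    refine ⟨ρ₀.isPositive.isSelfAdjoint.add θ.1.isSelfAdjoint, fun ψ => ?_⟩
    by_cases h : ψ = 0
    · simp [h, ContinuousLinearMap.reApplyInnerSelf]
    · have := (θ.2 ψ h).le
      rw [ContinuousLinearMap.reApplyInnerSelf, ← inner_conj_symm, RCLike.conj_re]
      exact this
  isTraceClass := ρ₀.isTraceClass.add θ.1.isTraceClass
  trace_eq_one := by
    rw [family, trace_add ρ₀.isTraceClass θ.1.isTraceClass, ρ₀.trace_eq_one, θ.1.trace_op,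
      add_zero]

end States

section Measurements

variable {H : Type u} [NormedAddCommGroup H] [InnerProductSpace ℂ H] [CompleteSpace H]
variable {Ω : Type*} [MeasurableSpace Ω]

/-- Positive operator-valued measures on `Ω`, countably additive in the weak sense. The values on
non-measurable sets play no role. -/
structure POVM (Ω : Type*) [MeasurableSpace Ω] (H : Type u) [NormedAddCommGroup H]
    [InnerProductSpace ℂ H] [CompleteSpace H] where
  val : Set Ω → H →L[ℂ] H
  isPositive : ∀ B, MeasurableSet B → (val B).IsPositive
  val_univ : val univ = 1
  hasSum_iUnion : ∀ B : ℕ → Set Ω, (∀ n, MeasurableSet (B n)) →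
    Pairwise (Function.onFun Disjoint B) →
    ∀ v w : H, HasSum (fun n => ⟪v, val (B n) w⟫_ℂ) ⟪v, val (⋃ n, B n) w⟫_ℂ

lemma exists_sqrt {M : H →L[ℂ] H} (hM : M.IsPositive) :
    ∃ S : H →L[ℂ] H, S† = S ∧ ∀ v w, ⟪v, M w⟫_ℂ = ⟪S v, S w⟫_ℂ := by
  have h0 : 0 ≤ M := (ContinuousLinearMap.nonneg_iff_isPositive M).mpr hM
  have hSa : (CFC.sqrt M)† = CFC.sqrt M := (CFC.sqrt_nonneg M).isSelfAdjoint.star_eq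
  refine ⟨CFC.sqrt M, hSa, fun v w => ?_⟩
  conv_lhs => rw [← CFC.sqrt_mul_sqrt_self M h0]
  change ⟪v, CFC.sqrt M (CFC.sqrt M w)⟫_ℂ = _
  rw [← ContinuousLinearMap.adjoint_inner_left, hSa]

lemma HasFactor.trace_mul {ι : Type u} {ρ M : H →L[ℂ] H} {x y : ι → H} (h : HasFactor ρ x y) :
    trace (ρ * M) = ∑' n, ⟪y n, M (x n)⟫_ℂ := by
  rw [(h.mul_right M).trace_eq]
  simp only [ContinuousLinearMap.adjoint_inner_left]

lemma trace_mul_nonneg {ρ M : H →L[ℂ] H} (hρ : ρ.IsPositive) (hρt : IsTraceClass ρ)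
    (hM : M.IsPositive) : 0 ≤ (trace (ρ * M)).re := by
  obtain ⟨ι, x, y, h⟩ := (isTraceClass_iff ρ).mp hρt
  obtain ⟨S, hSa, hS⟩ := exists_sqrt hM
  have h2 := (h.mul_left S).mul_right S
  have e : trace (ρ * M) = trace (S * ρ * S) := by
    rw [h.trace_mul, h2.trace_eq]
    simp only [hS, hSa]
  rw [e, trace, Complex.re_tsum (h2.hasSum_trace _).summable]
  refine tsum_nonneg fun i => ?_
  change 0 ≤ (⟪_, S (ρ (S _))⟫_ℂ).re
  rw [← ContinuousLinearMap.adjoint_inner_left, hSa]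
  exact hρ.re_inner_nonneg_right _

lemma POVM.hasSum_trace (M : POVM Ω H) {ρ : H →L[ℂ] H} (hρ : IsTraceClass ρ) (B : ℕ → Set Ω)
    (hB : ∀ n, MeasurableSet (B n)) (hd : Pairwise (Function.onFun Disjoint B)) :
    HasSum (fun n => trace (ρ * M.val (B n))) (trace (ρ * M.val (⋃ n, B n))) := by
  obtain ⟨ι, x, y, h⟩ := (isTraceClass_iff ρ).mp hρ
  simp only [h.trace_mul]
  have hx := h.1
  have hy := h.2.1
  have key : ∀ z : ι → H, (Summable fun i => ‖z i‖ ^ 2) →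
      Summable fun p : ι × ℕ => (⟪z p.1, M.val (B p.2) (z p.1)⟫_ℂ).re := by
    intro z hz
    have hnn : 0 ≤ fun p : ι × ℕ => (⟪z p.1, M.val (B p.2) (z p.1)⟫_ℂ).re :=
      fun p => (M.isPositive _ (hB p.2)).re_inner_nonneg_right _
    rw [summable_prod_of_nonneg hnn]
    have hk := fun i => Complex.hasSum_re (M.hasSum_iUnion B hB hd (z i) (z i))
    refine ⟨fun i => (hk i).summable, ?_⟩
    simp only [fun i => (hk i).tsum_eq]
    refine Summable.of_nonneg_of_le
      (fun i => (M.isPositive _ (MeasurableSet.iUnion hB)).re_inner_nonneg_right _)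
      (fun i => ?_) (hz.mul_left ‖M.val (⋃ n, B n)‖)
    calc _ ≤ ‖⟪z i, M.val (⋃ n, B n) (z i)⟫_ℂ‖ := Complex.re_le_norm _
      _ ≤ ‖z i‖ * ‖M.val (⋃ n, B n) (z i)‖ := norm_inner_le_norm _ _
      _ ≤ ‖z i‖ * (‖M.val (⋃ n, B n)‖ * ‖z i‖) := by
        gcongr
        exact ContinuousLinearMap.le_opNorm _ _
      _ = _ := by ring
  have hs : Summable fun p : ι × ℕ => ⟪y p.1, M.val (B p.2) (x p.1)⟫_ℂ := by
    refine Summable.of_norm_bounded ((key x hx).add (key y hy)) fun p => ?_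
    obtain ⟨S, -, hS⟩ := exists_sqrt (M.isPositive _ (hB p.2))
    have hn : ∀ v : H, (⟪S v, S v⟫_ℂ).re = ‖S v‖ ^ 2 := fun v => by
      simpa using inner_self_eq_norm_sq (𝕜 := ℂ) (S v)
    simp only [hS, hn]
    have := norm_inner_le_norm (𝕜 := ℂ) (S (y p.1)) (S (x p.1))
    nlinarith [sq_nonneg (‖S (y p.1)‖ - ‖S (x p.1)‖), sq_nonneg ‖S (y p.1)‖,
      sq_nonneg ‖S (x p.1)‖]
  have h2 := hs.hasSum.prod_fiberwise fun i => M.hasSum_iUnion B hB hd (y i) (x i)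
  have h3 : HasSum (fun q : ℕ × ι => ⟪y q.2, M.val (B q.1) (x q.2)⟫_ℂ)
      (∑' p : ι × ℕ, ⟪y p.1, M.val (B p.2) (x p.1)⟫_ℂ) :=
    (Equiv.prodComm ℕ ι).hasSum_iff.mpr hs.hasSum
  rw [h2.tsum_eq]
  exact h3.prod_fiberwise fun n => (h3.summable.prod_factor n).hasSum

/-- The outcome distribution `P(B) = Tr[ρ M(B)]` of the measurement `M` in the state `ρ`. -/
def outcomeMeasure (M : POVM Ω H) (ρ : DensityOperator H) : Measure Ω :=
  Measure.ofMeasurable (fun B _ => ENNReal.ofReal (trace (ρ.op * M.val B)).re)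
    (by
      have h := M.hasSum_trace ρ.isTraceClass (fun _ => ∅) (fun _ => MeasurableSet.empty)
        (fun _ _ _ => disjoint_bot_left)
      have h0 : trace (ρ.op * M.val ∅) = 0 := by
        simpa using tendsto_nhds_unique (tendsto_const_nhds) h.summable.tendsto_atTop_zero
      simp [h0])
    (by
      intro B hB hd
      have h := Complex.hasSum_re (M.hasSum_trace ρ.isTraceClass B hB hd)
      rw [← h.tsum_eq]
      exact ENNReal.ofReal_tsum_of_nonneg
        (fun n => trace_mul_nonneg ρ.isPositive ρ.isTraceClass (M.isPositive _ (hB n)))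
        h.summable)

lemma outcomeMeasure_apply (M : POVM Ω H) (ρ : DensityOperator H) {B : Set Ω}
    (hB : MeasurableSet B) :
    outcomeMeasure M ρ B = ENNReal.ofReal (trace (ρ.op * M.val B)).re :=
  Measure.ofMeasurable_apply B hB

/-- `κ` is the logarithmic gradient at `θ` of the family of outcome distributions
`P_θ(B) = Tr[ρ(θ) M(B)]`, and `‖κ‖` is square integrable: for every event `B` the function
`θ ↦ P_θ(B)` is Fréchet differentiable, and its derivative in the direction `φ` is
`∫_B (κ(x), φ) P_θ(dx)`. In other words, `x ↦ (κ(x), φ)` is the Radon-Nikodym derivative with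
respect to `P_θ` of the derivative of `P_θ` in the direction `φ`. -/
def IsLogGradient (M : POVM Ω H) (ρ₀ : DensityOperator H) (θ : parameterSpace ρ₀)
    (κ : Ω → XiHilbert H) : Prop :=
  MemLp κ 2 (outcomeMeasure M (state ρ₀ θ)) ∧
    ∀ B, MeasurableSet B → ∃ D : Xi H →L[ℝ] ℝ,
      HasFDerivAt (fun θ' : Xi H => (trace (family ρ₀ θ' * M.val B)).re) D θ ∧
      ∀ φ : Xi H, D φ = ∫ x in B, ⟪κ x, (φ : XiHilbert H)⟫_ℝ ∂outcomeMeasure M (state ρ₀ θ)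

/-- The Fisher information operator `J = E[κ κ*]`. -/
def fisherOperator (P : Measure Ω) (κ : Ω → XiHilbert H) : XiHilbert H →L[ℝ] XiHilbert H :=
  ∫ x, InnerProductSpace.rankOne ℝ (κ x) (κ x) ∂P

/-- `S` is a Moore-Penrose inverse of the everywhere defined operator `J`: the four Penrose
equations `J S J = J`, `S J S = S`, `(J S)* = J S`, `(S J)* = S J`. The linear operator `S` may be
unbounded, with a domain that contains the range of `J`; an everywhere defined `S` is the case
`S.domain = ⊤`. -/
def IsMoorePenroseInverse {E : Type*} [NormedAddCommGroup E] [InnerProductSpace ℝ E]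
    (J : E →L[ℝ] E) (S : E →ₗ.[ℝ] E) : Prop :=
  ∃ hJ : ∀ x, J x ∈ S.domain,
    (∀ x, J (S ⟨J x, hJ x⟩) = J x) ∧
    (∀ y : S.domain, S ⟨J (S y), hJ (S y)⟩ = S y) ∧
    (∀ y z : S.domain, ⟪J (S y), (z : E)⟫_ℝ = ⟪(y : E), J (S z)⟫_ℝ) ∧
    (∀ x z : E, ⟪S ⟨J x, hJ x⟩, z⟫_ℝ = ⟪x, S ⟨J z, hJ z⟩⟫_ℝ)

end Measurements

section Observables

variable {H : Type u} [NormedAddCommGroup H] [InnerProductSpace ℂ H] [CompleteSpace H]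

/-- The product `A B` of two possibly unbounded operators, with domain
`{ψ ∈ dom B | B ψ ∈ dom A}`. -/
def opMul (A B : H →ₗ.[ℂ] H) : H →ₗ.[ℂ] H :=
  A.comp (B.domRestrict ((A.domain.comap B.toFun).map B.domain.subtype)) (by
    rintro ⟨ψ, hψ⟩
    obtain ⟨⟨χ, hχ⟩, h1, h2⟩ := hψ.1
    simp only [Submodule.subtype_apply] at h2
    subst h2
    exact h1)

/-- `T` is a trace-class operator that extends `σ X`. -/
def IsTraceClassProduct (σ : H →L[ℂ] H) (X : H →ₗ.[ℂ] H) (T : H →L[ℂ] H) : Prop :=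
  IsTraceClass T ∧ ∀ ψ : X.domain, T ψ = σ (X ψ)

/-- The densely defined operators `X` with `σ X` of trace class, that is, those with a finite
expectation value in the state `σ`. -/
def finiteExpectation (σ : H →L[ℂ] H) : Set (H →ₗ.[ℂ] H) :=
  {X | Dense (X.domain : Set H) ∧ ∃ T, IsTraceClassProduct σ X T}

/-- The self-adjoint operators with a finite expectation value in the state `σ`. -/
def observables (σ : H →L[ℂ] H) : Set (H →ₗ.[ℂ] H) :=
  {A | IsSelfAdjoint A ∧ A ∈ finiteExpectation σ}

open Classical in
/-- The expectation value `Tr[σ X]`. -/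
def expectation (σ : H →L[ℂ] H) (X : H →ₗ.[ℂ] H) : ℂ :=
  if h : X ∈ finiteExpectation σ then trace h.2.choose else 0

/-- The correlation `⟨A B⟩ - ⟨A⟩ ⟨B⟩` of self-adjoint operators. -/
def correlation (σ : H →L[ℂ] H) (A B : H →ₗ.[ℂ] H) : ℂ :=
  expectation σ (opMul A B) - expectation σ A * expectation σ B

/-- The symmetrized correlation, which is real for observables. -/
def symCorrelation (σ : H →L[ℂ] H) (A B : H →ₗ.[ℂ] H) : ℝ :=
  ((1 / 2 : ℂ) * (correlation σ A B + correlation σ B A)).re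

/-- The variance `⟨A²⟩ - ⟨A⟩²`, which is real for observables. -/
def variance (σ : H →L[ℂ] H) (A : H →ₗ.[ℂ] H) : ℝ :=
  (correlation σ A A).re

/-- The commutator `A B - B A`. -/
def opCommutator (A B : H →ₗ.[ℂ] H) : H →ₗ.[ℂ] H := opMul A B - opMul B A

/-- `g` is the gradient at `θ` of `θ ↦ ⟨A⟩_θ = Tr[ρ(θ) A]`: the Fréchet derivative, along the
parameters for which the expectation value is finite, is `φ ↦ (g, φ)`. -/
def IsExpectationGradient (ρ₀ : DensityOperator H) (θ : Xi H) (A : H →ₗ.[ℂ] H)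
    (g : XiHilbert H) : Prop :=
  HasFDerivWithinAt (fun θ' : Xi H => (expectation (family ρ₀ θ') A).re)
    ((innerSL ℝ g).comp (UniformSpace.Completion.toComplL : Xi H →L[ℝ] XiHilbert H))
    {θ' : Xi H | A ∈ finiteExpectation (family ρ₀ θ')} θ

open Classical in
/-- The measurement error of `A`, for a measurement with Fisher information operator `J`, where
`S` is the Moore-Penrose inverse of `J` and `g` is the gradient of the expectation value of `A`:
`(g, S g) - σ²(A)` if `g` is orthogonal to `ker J`, and `+∞` otherwise. -/
def measurementError (σ : H →L[ℂ] H) (A : H →ₗ.[ℂ] H) (J : XiHilbert H →L[ℝ] XiHilbert H)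
    (S : XiHilbert H →ₗ.[ℝ] XiHilbert H) (g : S.domain) : EReal :=
  if (g : XiHilbert H) ∈ (LinearMap.ker J.toLinearMap)ᗮ then
    ((⟪(g : XiHilbert H), S g⟫_ℝ - variance σ A : ℝ) : EReal)
  else ⊤

/-- The quantity `(∇⟨A⟩, S ∇⟨B⟩) - C^S(A, B)`, with `S` the Moore-Penrose inverse of the Fisher
information operator. -/
def residualCorrelation (σ : H →L[ℂ] H) (A B : H →ₗ.[ℂ] H) (S : XiHilbert H →ₗ.[ℝ] XiHilbert H)
    (gA gB : S.domain) : ℝ :=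
  ⟪(gA : XiHilbert H), S gB⟫_ℝ - symCorrelation σ A B

open Classical in
/-- The product of two errors. A product with an infinite factor is infinite, also when the other
factor is zero. -/
def errorMul (a b : EReal) : EReal := if a = ⊤ ∨ b = ⊤ then ⊤ else a * b

end Observables

end QuantumEstimation

end

open QuantumEstimation

/-! The gradient hypothesis is strong. If `⟨A⟩` is differentiable for the Hilbert-Schmidt norm,
testing the gradient `g` on the directions `|u⟩⟨u| - |v⟩⟨v|` with unit vectors `u`, `v` in the
domain bounds `⟨u, A u⟩ - ⟨v, A v⟩` by `2‖g‖`. Hence `A` is bounded and everywhere defined, and `(g,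
φ) = Re Tr[φ A]` (`IsExpectationGradient.exists_bounded`). All products then become products of
bounded operators, and `A`, `B` may be centred.

If `g` is orthogonal to `ker J`, then `J a = g` for `a = S g` (`IsMoorePenroseInverse.apply_apply`),
and `x ↦ (κ(x), a)` is a locally unbiased estimator of the centred observable, with second moment
`(J a, a) = (g, S g)`.

The core is `IsLogGradient.trace_le_inner_fisherOperator`. For centred self-adjoint `A₁`, `A₂` with
estimators `f₁`, `f₂`, put `C = A₁ + i A₂` and `f = f₁ + i f₂`. Formally, `∫ (f - C)* dM (f - C)` is
a positive operator. Its expectation in `ρ` is `E|f|² - (cross term) + Tr[ρ C* C]`, and local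
unbiasedness makes the cross term equal to `2 Tr[ρ C* C]`. Thus `E|f|² ≥ Tr[ρ C* C]`. The integral
is only formed for simple functions, where it is a finite sum; the bound passes to `f` by density in
`L²`.

Applied to `C = p A + (q - i r) B`, this says that a Hermitian 2×2 form is nonnegative. Its diagonal
entries are the two errors, and its off-diagonal entry has real part `R(A, B)` and imaginary part of
modulus `|⟨[A, B]⟩| / 2`. The theorem is the nonnegativity of its determinant
(`IsLogGradient.sq_add_sq_le`). -/

namespace QuantumEstimation

universe u

/-! ### Trace identities and special directions in `Ξ`. -/

section Trace

variable {H : Type u} [NormedAddCommGroup H] [InnerProductSpace ℂ H] [CompleteSpace H]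

lemma IsTraceClass.smul_complex {T : H →L[ℂ] H} (hT : IsTraceClass T) (c : ℂ) :
    IsTraceClass (c • T) := by
  simpa using hT.mul_left (c • (1 : H →L[ℂ] H))

lemma IsTraceClass.sub {S T : H →L[ℂ] H} (hS : IsTraceClass S) (hT : IsTraceClass T) :
    IsTraceClass (S - T) := by
  simpa [sub_eq_add_neg] using hS.add (hT.smul (-1))

lemma trace_smul_complex (c : ℂ) (T : H →L[ℂ] H) : trace (c • T) = c * trace T := by
  simp [trace, ← tsum_mul_left]

lemma trace_sub {S T : H →L[ℂ] H} (hS : IsTraceClass S) (hT : IsTraceClass T) :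
    trace (S - T) = trace S - trace T := by
  have h := trace_add hS (hT.smul (-1))
  rw [trace_smul] at h
  simpa [sub_eq_add_neg] using h

/-- Cyclicity of the trace. -/
lemma trace_mul_comm {T : H →L[ℂ] H} (hT : IsTraceClass T) (X : H →L[ℂ] H) :
    trace (T * X) = trace (X * T) := by
  obtain ⟨ι, x, y, h⟩ := (isTraceClass_iff T).mp hT
  rw [h.trace_mul, (h.mul_left X).trace_eq]

lemma trace_star (T : H →L[ℂ] H) : trace (star T) = star (trace T) := by
  rw [trace, trace, ← starRingEnd_apply, Complex.conj_tsum]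
  refine tsum_congr fun i => ?_
  rw [ContinuousLinearMap.star_eq_adjoint, ContinuousLinearMap.adjoint_inner_right,
    inner_conj_symm]

lemma hasFactor_rankOne {H : Type u} [NormedAddCommGroup H] [InnerProductSpace ℂ H]
    (u v : H) :
    HasFactor (InnerProductSpace.rankOne ℂ u v) (fun _ : PUnit.{u + 1} => u) (fun _ => v) := by
  refine ⟨(hasSum_fintype _).summable, (hasSum_fintype _).summable, fun a b => ?_⟩
  simp [mul_comm]

lemma isTraceClass_rankOne (u v : H) : IsTraceClass (InnerProductSpace.rankOne ℂ u v) :=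
  (isTraceClass_iff _).mpr ⟨_, _, _, hasFactor_rankOne u v⟩

lemma trace_rankOne (u v : H) : trace (InnerProductSpace.rankOne ℂ u v) = ⟪v, u⟫_ℂ := by
  rw [(hasFactor_rankOne u v).trace_eq]
  simp

lemma trace_rankOne_mul (u v : H) (X : H →L[ℂ] H) :
    trace (InnerProductSpace.rankOne ℂ u v * X) = ⟪v, X u⟫_ℂ := by
  rw [(hasFactor_rankOne u v).trace_mul]
  simp

/-- The traceless part `h - Tr[h] ρ` of a self-adjoint trace-class operator, as an element of
`Ξ`. -/
noncomputable def Xi.ofCentered (ρ : DensityOperator H) (h : H →L[ℂ] H) (ht : IsTraceClass h)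
    (hs : IsSelfAdjoint h) : Xi H :=
  ⟨h - (trace h).re • ρ.op, ht.sub (ρ.isTraceClass.smul _),
    hs.sub ((IsSelfAdjoint.all _).smul ρ.isPositive.isSelfAdjoint), by
      -- A self-adjoint operator has real trace, so subtracting the real part of the trace times `ρ`
      -- removes all of it.
      have : (trace h).im = 0 := by
        have := trace_star h
        rw [hs.star_eq] at this
        exact Complex.conj_eq_iff_im.mp this.symm
      rw [trace_sub ht (ρ.isTraceClass.smul _), trace_smul, ρ.trace_eq_one, mul_one, sub_eq_zero]
      exact Complex.ext (by simp) (by simp [this])⟩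

lemma Xi.op_ofCentered (ρ : DensityOperator H) (h : H →L[ℂ] H) (ht : IsTraceClass h)
    (hs : IsSelfAdjoint h) : (Xi.ofCentered ρ h ht hs).op = h - (trace h).re • ρ.op := rfl

/-- The difference of two one-dimensional projections, as a direction in `Ξ`. -/
noncomputable def Xi.projSub (u v : H) (h : ‖u‖ = ‖v‖) : Xi H :=
  ⟨InnerProductSpace.rankOne ℂ u u - InnerProductSpace.rankOne ℂ v v,
    (isTraceClass_rankOne u u).sub (isTraceClass_rankOne v v),
    (InnerProductSpace.isPositive_rankOne_self u).isSelfAdjoint.sub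
      (InnerProductSpace.isPositive_rankOne_self v).isSelfAdjoint, by
      rw [trace_sub (isTraceClass_rankOne u u) (isTraceClass_rankOne v v), trace_rankOne,
        trace_rankOne, inner_self_eq_norm_sq_to_K, inner_self_eq_norm_sq_to_K, h, sub_self]⟩

lemma Xi.op_projSub (u v : H) (h : ‖u‖ = ‖v‖) : (Xi.projSub u v h).op =
    InnerProductSpace.rankOne ℂ u u - InnerProductSpace.rankOne ℂ v v := rfl

lemma Xi.inner_eq (φ χ : Xi H) : ⟪φ, χ⟫_ℝ = (trace (φ.op * χ.op)).re := by
  have h : (φ.op)† = φ.op := φ.isSelfAdjoint.star_eq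
  change (trace ((φ.op†) * χ.op)).re = _
  rw [h]

lemma Xi.op_add (φ χ : Xi H) : (φ + χ).op = φ.op + χ.op := rfl

lemma Xi.op_smul (t : ℝ) (φ : Xi H) : (t • φ).op = t • φ.op := rfl

lemma family_add_smul (ρ₀ : DensityOperator H) (θ φ : Xi H) (t : ℝ) :
    family ρ₀ (θ + t • φ) = family ρ₀ θ + t • φ.op := by
  simp [family, Xi.op_add, Xi.op_smul, add_assoc]

/-- Only a bound uniform in `u` and `v` matters, so the sharp constant `√2` is not sought: `‖φ‖² =
⟨u, φ u⟩ - ⟨v, φ v⟩`, and each term is at most 2 in modulus. -/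
lemma Xi.norm_projSub_le (u v : H) (hu : ‖u‖ = 1) (hv : ‖v‖ = 1) :
    ‖Xi.projSub u v (hu.trans hv.symm)‖ ≤ 2 := by
  set φ := Xi.projSub u v (hu.trans hv.symm)
  have hb : ∀ w : H, ‖w‖ = 1 → ‖φ.op w‖ ≤ 2 := fun w hw => by
    have e : φ.op w = ⟪u, w⟫_ℂ • u - ⟪v, w⟫_ℂ • v := by simp [φ, Xi.op_projSub]
    have h1 := norm_inner_le_norm (𝕜 := ℂ) u w
    have h2 := norm_inner_le_norm (𝕜 := ℂ) v w
    rw [e]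
    refine (norm_sub_le _ _).trans ?_
    rw [norm_smul, norm_smul]
    rw [hu, hw] at h1
    rw [hv, hw] at h2
    rw [hu, hv]
    linarith
  have h : ‖φ‖ ^ 2 ≤ 4 := by
    rw [← real_inner_self_eq_norm_sq, Xi.inner_eq]
    -- Only the left factor of `Tr[φ φ]` is expanded; the right one is kept as `φ`, to be estimated
    -- by `hb`.
    conv_lhs => enter [1, 1, 1]; rw [Xi.op_projSub]
    rw [sub_mul, trace_sub ((isTraceClass_rankOne u u).mul_right _)
      ((isTraceClass_rankOne v v).mul_right _), trace_rankOne_mul, trace_rankOne_mul]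
    refine (Complex.re_le_norm _).trans ((norm_sub_le _ _).trans ?_)
    have h1 := norm_inner_le_norm (𝕜 := ℂ) u (φ.op u)
    have h2 := norm_inner_le_norm (𝕜 := ℂ) v (φ.op v)
    rw [hu] at h1
    rw [hv] at h2
    linarith [hb u hu, hb v hv]
  nlinarith [norm_nonneg φ]

end Trace

/-! ### Expectation values, and boundedness of observables that have a gradient. -/

section Expectation

variable {H : Type u} [NormedAddCommGroup H] [InnerProductSpace ℂ H] [CompleteSpace H]

/-- Two bounded operators that agree on a dense domain are equal, so the choice of extension in
`expectation` is immaterial. -/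
lemma expectation_eq {σ T : H →L[ℂ] H} {X : H →ₗ.[ℂ] H} (hd : Dense (X.domain : Set H))
    (hT : IsTraceClassProduct σ X T) : expectation σ X = trace T := by
  have h : X ∈ finiteExpectation σ := ⟨hd, T, hT⟩
  rw [expectation, dif_pos h]
  congr 1
  refine ContinuousLinearMap.coe_inj.mp (LinearMap.coe_injective ?_)
  refine Continuous.ext_on hd (ContinuousLinearMap.continuous _) (ContinuousLinearMap.continuous _)
    fun ψ hψ => ?_
  exact (h.2.choose_spec.2 ⟨ψ, hψ⟩).trans (hT.2 ⟨ψ, hψ⟩).symm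

/-- The gradient of an expectation value is determined by its values on the directions `φ` for
which `φ A` is of trace class. -/
lemma IsExpectationGradient.inner_eq {ρ₀ : DensityOperator H} {θ : Xi H} {A : H →ₗ.[ℂ] H}
    {g : XiHilbert H} (hg : IsExpectationGradient ρ₀ θ A g)
    (hA : A ∈ finiteExpectation (family ρ₀ θ)) {φ : Xi H} {T : H →L[ℂ] H}
    (hT : IsTraceClassProduct φ.op A T) : ⟪g, (φ : XiHilbert H)⟫_ℝ = (trace T).re := by
  obtain ⟨hd, T₀, hT₀⟩ := hA
  -- The whole line `θ + t φ` stays among the parameters with finite expectation, whether or not `ρ₀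
  -- + θ + t φ` is positive. The expectation is affine on it, and uniqueness of the derivative of a
  -- function of `t` identifies `(g, φ)`.
  have hprod : ∀ t : ℝ, IsTraceClassProduct (family ρ₀ (θ + t • φ)) A (T₀ + t • T) := fun t =>
    ⟨hT₀.1.add (hT.1.smul t), fun ψ => by
      simp [family_add_smul, hT₀.2 ψ, hT.2 ψ]⟩
  have hexp : ∀ t : ℝ, (expectation (family ρ₀ (θ + t • φ)) A).re
      = (trace T₀).re + t * (trace T).re := fun t => by
    rw [expectation_eq hd (hprod t), trace_add hT₀.1 (hT.1.smul t), trace_smul, Complex.add_re,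
      Complex.re_ofReal_mul]
  have hline : HasDerivWithinAt (fun t : ℝ => θ + t • φ) φ univ 0 := by
    have := ((hasDerivAt_id (0 : ℝ)).smul_const φ).const_add θ
    rw [one_smul] at this
    exact this.hasDerivWithinAt
  have h0 : θ + (0 : ℝ) • φ = θ := by simp
  have h1 : HasDerivWithinAt
      ((fun θ' : Xi H => (expectation (family ρ₀ θ') A).re) ∘ fun t : ℝ => θ + t • φ)
      (⟪g, (φ : XiHilbert H)⟫_ℝ) univ 0 := by
    have hg' := hg
    rw [IsExpectationGradient, ← h0] at hg'
    have hm : MapsTo (fun t : ℝ => θ + t • φ) univ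
        {θ' : Xi H | A ∈ finiteExpectation (family ρ₀ θ')} := fun t _ => ⟨hd, _, hprod t⟩
    exact hg'.comp_hasDerivWithinAt (0 : ℝ) hline hm
  have h2 : HasDerivAt (fun t : ℝ => (trace T₀).re + t * (trace T).re) (trace T).re 0 := by
    simpa using ((hasDerivAt_id (0 : ℝ)).mul_const (trace T).re).const_add (trace T₀).re
  refine (hasDerivWithinAt_univ.mp h1).unique ?_
  exact h2.congr_of_eventuallyEq (Filter.Eventually.of_forall hexp)

/-- An observable whose expectation value has a gradient for the Hilbert-Schmidt norm is bounded. -/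
lemma IsExpectationGradient.norm_apply_le {ρ₀ : DensityOperator H} {θ : Xi H} {A : H →ₗ.[ℂ] H}
    {g : XiHilbert H} (hg : IsExpectationGradient ρ₀ θ A g)
    (hA : A ∈ observables (family ρ₀ θ)) : ∃ C : ℝ, ∀ ψ : A.domain, ‖A ψ‖ ≤ C * ‖ψ‖ := by
  obtain ⟨hsa, hfin⟩ := hA
  have hd := hfin.1
  have hsym : ∀ x y : A.domain, ⟪A x, (y : H)⟫_ℂ = ⟪(x : H), A y⟫_ℂ := by
    have h := LinearPMap.adjoint_isFormalAdjoint hd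
    rw [LinearPMap.isSelfAdjoint_def.mp hsa] at h
    exact h
  set q : A.domain → ℝ := fun ψ => (⟪A ψ, (ψ : H)⟫_ℂ).re with hq
  have hdiff : ∀ u v : A.domain, ‖u‖ = 1 → ‖v‖ = 1 → q u - q v ≤ 2 * ‖g‖ := by
    intro u v hu hv
    have hu' : ‖(u : H)‖ = 1 := hu
    have hv' : ‖(v : H)‖ = 1 := hv
    -- By symmetry of `A`, the product `|u⟩⟨u| A` extends to the bounded operator `|u⟩⟨A u|`.
    have ht : IsTraceClassProduct (Xi.projSub (u : H) v (hu'.trans hv'.symm)).op A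
        (InnerProductSpace.rankOne ℂ (u : H) (A u) - InnerProductSpace.rankOne ℂ (v : H) (A v)) :=
      ⟨(isTraceClass_rankOne _ _).sub (isTraceClass_rankOne _ _), fun ψ => by
        simp [Xi.op_projSub, hsym]⟩
    have h := hg.inner_eq hfin ht
    rw [trace_sub (isTraceClass_rankOne _ _) (isTraceClass_rankOne _ _), trace_rankOne,
      trace_rankOne, Complex.sub_re] at h
    change _ = q u - q v at h
    rw [← h]
    refine (real_inner_le_norm _ _).trans ?_
    rw [UniformSpace.Completion.norm_coe, mul_comm]
    gcongr
    exact Xi.norm_projSub_le _ _ hu' hv'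
  have hscale : ∀ (r : ℝ) (ψ : A.domain), q ((r : ℂ) • ψ) = r ^ 2 * q ψ := fun r ψ => by
    simp only [hq, LinearPMap.map_smul, Submodule.coe_smul, inner_smul_left, inner_smul_right,
      Complex.conj_ofReal, ← mul_assoc, ← Complex.ofReal_mul, Complex.re_ofReal_mul]
    ring
  obtain ⟨C, hC0, hC⟩ : ∃ C : ℝ, 0 ≤ C ∧ ∀ ψ : A.domain, |q ψ| ≤ C * ‖ψ‖ ^ 2 := by
    -- A fixed unit vector `v` turns the bound on differences into a bound on `q`; if the domain has
    -- no unit vector, it is zero.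
    by_cases hv : ∃ v : A.domain, ‖v‖ = 1
    · obtain ⟨v, hv⟩ := hv
      refine ⟨2 * ‖g‖ + |q v|, by positivity, fun ψ => ?_⟩
      by_cases hψ : ψ = 0
      · simp [hψ, hq]
      have hn : 0 < ‖ψ‖ := norm_pos_iff.mpr hψ
      set w : A.domain := ((‖ψ‖⁻¹ : ℝ) : ℂ) • ψ with hw
      have hw1 : ‖w‖ = 1 := by
        rw [hw, norm_smul, Complex.norm_real, norm_inv, norm_norm, inv_mul_cancel₀ hn.ne']
      have hqw : q ψ = ‖ψ‖ ^ 2 * q w := by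
        rw [hw, hscale]
        field_simp
      have h1 := hdiff w v hw1 hv
      have h2 := hdiff v w hv hw1
      rw [hqw, abs_mul, abs_of_nonneg (by positivity : 0 ≤ ‖ψ‖ ^ 2), mul_comm]
      gcongr
      rw [abs_le]
      constructor <;> linarith [le_abs_self (q v), neg_abs_le (q v)]
    · refine ⟨0, le_rfl, fun ψ => ?_⟩
      have hψ : ψ = 0 := by
        by_contra h
        have hn : 0 < ‖ψ‖ := norm_pos_iff.mpr h
        refine hv ⟨((‖ψ‖⁻¹ : ℝ) : ℂ) • ψ, ?_⟩
        rw [norm_smul, Complex.norm_real, norm_inv, norm_norm, inv_mul_cancel₀ hn.ne']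
      simp [hψ, hq]
  -- Polarization and the parallelogram law bound the sesquilinear form by the quadratic one. The
  -- extension from the domain to all `w : H` is needed because `A u` will be inserted for `w`, and
  -- it need not lie in the domain.
  have hpol : ∀ (u : A.domain) (w : H), (⟪A u, w⟫_ℂ).re ≤ C / 2 * (‖u‖ ^ 2 + ‖w‖ ^ 2) := by
    intro u w
    refine hd.induction (P := fun w => (⟪A u, w⟫_ℂ).re ≤ C / 2 * (‖u‖ ^ 2 + ‖w‖ ^ 2)) ?_
      (isClosed_le (by fun_prop) (by fun_prop)) w
    intro w hw
    lift w to A.domain using hw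
    have e : 4 * (⟪A u, (w : H)⟫_ℂ).re = q (u + w) - q (u - w) := by
      have : (⟪A w, (u : H)⟫_ℂ).re = (⟪A u, (w : H)⟫_ℂ).re := by
        rw [hsym w u, ← inner_conj_symm, Complex.conj_re]
      simp only [hq, LinearPMap.map_add, LinearPMap.map_sub, Submodule.coe_add, Submodule.coe_sub,
        inner_add_left, inner_add_right, inner_sub_left, inner_sub_right, Complex.add_re,
        Complex.sub_re, this]
      ring
    have hp := parallelogram_law_with_norm ℂ (u : H) (w : H)
    have h1 := (abs_le.mp (hC (u + w))).2
    have h2 := (abs_le.mp (hC (u - w))).1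
    have hp' : ‖u + w‖ ^ 2 + ‖u - w‖ ^ 2 = 2 * (‖u‖ ^ 2 + ‖(w : H)‖ ^ 2) := hp
    nlinarith
  refine ⟨C, fun u => ?_⟩
  by_cases hAu : A u = 0
  · rw [hAu, norm_zero]
    positivity
  have hn : 0 < ‖A u‖ := norm_pos_iff.mpr hAu
  have hu : 0 < ‖u‖ := norm_pos_iff.mpr fun h => hAu (by rw [h]; exact A.map_zero)
  -- `A u` is rescaled to the norm of `u`, which balances the two terms on the right and yields
  -- exactly the constant `C`.
  have h := hpol u (((‖u‖ / ‖A u‖ : ℝ) : ℂ) • A u)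
  rw [inner_smul_right, Complex.re_ofReal_mul, norm_smul] at h
  have e : (⟪A u, A u⟫_ℂ).re = ‖A u‖ ^ 2 := by
    simpa using inner_self_eq_norm_sq (𝕜 := ℂ) (A u)
  rw [e, Complex.norm_real, Real.norm_of_nonneg (by positivity), div_mul_cancel₀ _ hn.ne'] at h
  have h' : ‖u‖ * ‖A u‖ ≤ ‖u‖ * (C * ‖u‖) := by
    calc ‖u‖ * ‖A u‖ = ‖u‖ / ‖A u‖ * ‖A u‖ ^ 2 := by field_simp
      _ ≤ _ := h
      _ = _ := by ring
  exact le_of_mul_le_mul_left h' hu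

/-- An observable whose expectation value has a gradient is an everywhere defined bounded
operator. -/
lemma IsExpectationGradient.exists_bounded {ρ₀ : DensityOperator H} {θ : Xi H} {A : H →ₗ.[ℂ] H}
    {g : XiHilbert H} (hg : IsExpectationGradient ρ₀ θ A g)
    (hA : A ∈ observables (family ρ₀ θ)) :
    ∃ A' : H →L[ℂ] H, IsSelfAdjoint A' ∧ A = A'.toPMap ⊤ ∧
      ∀ φ : Xi H, ⟪g, (φ : XiHilbert H)⟫_ℝ = (trace (φ.op * A')).re := by
  obtain ⟨C, hC⟩ := hg.norm_apply_le hA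
  obtain ⟨hsa, hfin⟩ := hA
  have hd := hfin.1
  have hsa' := LinearPMap.isSelfAdjoint_def.mp hsa
  have htop : A.domain = ⊤ := by
    refine Submodule.eq_top_iff'.mpr fun y => ?_
    -- Since `A` is bounded, `x ↦ ⟨y, A x⟩` is continuous for every `y`; thus the adjoint is
    -- everywhere defined, and so is `A`.
    rw [← hsa', LinearPMap.mem_adjoint_domain_iff]
    have := (LinearMap.mkContinuous A.toFun C hC).continuous
    exact (innerSL ℂ y).continuous.comp this
  have hmem : ∀ ψ : H, ψ ∈ A.domain := fun ψ => htop ▸ Submodule.mem_top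
  let A' : H →L[ℂ] H := LinearMap.mkContinuous
    (A.toFun ∘ₗ LinearMap.codRestrict A.domain LinearMap.id hmem) C fun ψ => hC ⟨ψ, hmem ψ⟩
  have hA' : ∀ (ψ : H) (h : ψ ∈ A.domain), A' ψ = A ⟨ψ, h⟩ := fun ψ h => rfl
  have hsym : ∀ x y : A.domain, ⟪A x, (y : H)⟫_ℂ = ⟪(x : H), A y⟫_ℂ := by
    have h := LinearPMap.adjoint_isFormalAdjoint hd
    rw [hsa'] at h
    exact h
  refine ⟨A', ?_, ?_, fun φ => ?_⟩
  · rw [ContinuousLinearMap.isSelfAdjoint_iff_isSymmetric]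
    exact fun x y => hsym ⟨x, hmem x⟩ ⟨y, hmem y⟩
  · refine LinearPMap.ext htop fun x hx hx' => ?_
    rfl
  · exact hg.inner_eq hfin ⟨φ.isTraceClass.mul_right A', fun ψ => rfl⟩

lemma expectation_toPMap {σ : H →L[ℂ] H} (hσ : IsTraceClass σ) (X : H →L[ℂ] H) :
    expectation σ ((X : H →ₗ[ℂ] H).toPMap ⊤) = trace (σ * X) :=
  expectation_eq (by simp) ⟨hσ.mul_right X, fun ψ => rfl⟩

lemma opMul_toPMap {H : Type u} [NormedAddCommGroup H] [InnerProductSpace ℂ H]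
    (X Y : H →L[ℂ] H) :
    opMul ((X : H →ₗ[ℂ] H).toPMap ⊤) ((Y : H →ₗ[ℂ] H).toPMap ⊤)
      = ((X * Y : H →L[ℂ] H) : H →ₗ[ℂ] H).toPMap ⊤ := by
  refine LinearPMap.ext ?_ fun x hx hx' => rfl
  refine Submodule.eq_top_iff'.mpr fun y => ?_
  exact ⟨⟨⟨y, trivial⟩, trivial, rfl⟩, trivial⟩

lemma opCommutator_toPMap (X Y : H →L[ℂ] H) :
    opCommutator ((X : H →ₗ[ℂ] H).toPMap ⊤) ((Y : H →ₗ[ℂ] H).toPMap ⊤)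
      = ((X * Y - Y * X : H →L[ℂ] H) : H →ₗ[ℂ] H).toPMap ⊤ := by
  rw [opCommutator, opMul_toPMap, opMul_toPMap]
  refine LinearPMap.ext ?_ fun x hx hx' => rfl
  simp [LinearPMap.sub_domain]

end Expectation

/-! ### Solving `J a = g` with an unbounded Moore-Penrose inverse. -/

section MoorePenrose

variable {E : Type*} [NormedAddCommGroup E] [InnerProductSpace ℝ E] {J : E →L[ℝ] E}
  {S : E →ₗ.[ℝ] E}

/-- A Moore-Penrose inverse of a symmetric operator is a right inverse on the vectors orthogonal
to the kernel. -/
lemma IsMoorePenroseInverse.apply_apply (hS : IsMoorePenroseInverse J S)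
    (hJ : ∀ x y, ⟪J x, y⟫_ℝ = ⟪x, J y⟫_ℝ) (g : S.domain)
    (hg : (g : E) ∈ (LinearMap.ker J.toLinearMap)ᗮ) : J (S g) = g := by
  obtain ⟨hdom, h1, -, h3, -⟩ := hS
  -- Symmetry of `J S` tested on vectors `J x`, together with `J S J = J`, shows that `J S g - g` is
  -- orthogonal to the range of `J`; by symmetry of `J` it lies in the kernel.
  have hker : J (J (S g) - g) = 0 := by
    refine ext_inner_right ℝ fun x => ?_
    have := h3 g ⟨J x, hdom x⟩
    simp only [h1] at this
    rw [hJ, inner_sub_left, this, sub_self, inner_zero_left]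
  have hmem : J (S g) - g ∈ LinearMap.ker J.toLinearMap := hker
  -- A kernel vector is orthogonal to `J (S g)` by symmetry and to `g` by hypothesis, so `J S g - g`
  -- is orthogonal to itself. No closed range is required.
  have hz : ⟪J (S g) - g, J (S g) - g⟫_ℝ = 0 := by
    rw [inner_sub_right, ← hJ, hker, inner_zero_left,
      (Submodule.mem_orthogonal _ _).mp hg _ hmem, sub_zero]
  exact sub_eq_zero.mp (inner_self_eq_zero.mp hz)

end MoorePenrose

/-! ### Passage from simple functions to `L²`, and the Fisher form as an integral. -/

section Integration

variable {Ω : Type*} [MeasurableSpace Ω] {P : Measure Ω}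

/-- A quadratic lower bound on simple functions extends to square integrable functions. -/
lemma integral_inner_sub_add_nonneg {E : Type*} [NormedAddCommGroup E] [InnerProductSpace ℝ E]
    {l f : Ω → E} (hl : MemLp l 2 P) (hf : MemLp f 2 P) (τ : ℝ)
    (h : ∀ s : SimpleFunc Ω E, MemLp s 2 P → 0 ≤ (∫ x, ⟪s x - l x, s x⟫_ℝ ∂P) + τ) :
    0 ≤ (∫ x, ⟪f x - l x, f x⟫_ℝ ∂P) + τ := by
  have key : ∀ {g : Ω → E} (hg : MemLp g 2 P),
      ⟪hg.toLp g - hl.toLp l, hg.toLp g⟫_ℝ = ∫ x, ⟪g x - l x, g x⟫_ℝ ∂P := fun {g} hg => by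
    rw [L2.inner_def]
    refine integral_congr_ae ?_
    filter_upwards [Lp.coeFn_sub (hg.toLp g) (hl.toLp l), hg.coeFn_toLp, hl.coeFn_toLp]
      with x h1 h2 h3
    rw [h1, Pi.sub_apply, h2, h3]
  rw [← key hf]
  -- With `l` fixed, `F ↦ (F - l, F) + τ` is continuous on `L²`, so its nonnegativity is a closed
  -- condition and can be checked on simple functions.
  refine (Lp.simpleFunc.denseRange (E := E) (μ := P) (by norm_num : (2 : ℝ≥0∞) ≠ ∞)).induction_on
    (p := fun F : Lp E 2 P => 0 ≤ ⟪F - hl.toLp l, F⟫_ℝ + τ) (hf.toLp f)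
    (isClosed_le (by fun_prop) (by fun_prop)) fun s => ?_
  have hs := Lp.simpleFunc.memLp s
  have e : ((s : Lp.simpleFunc E 2 P) : Lp E 2 P) = hs.toLp _ := by
    conv_lhs => rw [← Lp.simpleFunc.toLp_toSimpleFunc s]
  rw [e, key hs]
  exact h _ hs

variable {H : Type u} [NormedAddCommGroup H] [InnerProductSpace ℂ H] [CompleteSpace H]

/-- The Fisher form is the Gram form of the estimators `x ↦ (κ(x), a)`: this gives the symmetry of
`J` and identifies `(J a, a)` with a second moment. -/
lemma inner_fisherOperator {κ : Ω → XiHilbert H} (hκ : MemLp κ 2 P) (a b : XiHilbert H) :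
    ⟪fisherOperator P κ a, b⟫_ℝ = ∫ x, ⟪κ x, a⟫_ℝ * ⟪κ x, b⟫_ℝ ∂P := by
  have hint : Integrable (fun x => InnerProductSpace.rankOne ℝ (κ x) (κ x)) P := by
    refine (hκ.integrable_norm_pow two_ne_zero).mono' ?_ (.of_forall fun x => ?_)
    · have hc : Continuous fun v : XiHilbert H => InnerProductSpace.rankOne ℝ v v :=
        (InnerProductSpace.rankOne ℝ).continuous.clm_apply continuous_id
      exact hc.comp_aestronglyMeasurable hκ.1
    · rw [InnerProductSpace.norm_rankOne, sq]
  rw [fisherOperator, ContinuousLinearMap.integral_apply hint, real_inner_comm,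
    ← integral_inner (hint.apply_continuousLinearMap a)]
  refine integral_congr_ae (.of_forall fun x => ?_)
  simp [inner_smul_right, real_inner_comm b]

end Integration

/-! ### Outcome distributions, scores and local unbiasedness. -/

section Measurement

variable {H : Type u} [NormedAddCommGroup H] [InnerProductSpace ℂ H] [CompleteSpace H]
variable {Ω : Type*} [MeasurableSpace Ω]

lemma POVM.val_empty (M : POVM Ω H) : M.val ∅ = 0 := by
  refine ContinuousLinearMap.ext fun w => ext_inner_left ℂ fun v => ?_
  have h := M.hasSum_iUnion (fun _ => ∅) (fun _ => MeasurableSet.empty)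
    (fun _ _ _ => disjoint_bot_left) v w
  simpa using tendsto_nhds_unique tendsto_const_nhds h.summable.tendsto_atTop_zero

lemma POVM.val_union (M : POVM Ω H) {E F : Set Ω} (hE : MeasurableSet E) (hF : MeasurableSet F)
    (hd : Disjoint E F) : M.val (E ∪ F) = M.val E + M.val F := by
  refine ContinuousLinearMap.ext fun w => ext_inner_left ℂ fun v => ?_
  let B : ℕ → Set Ω := fun n => if n = 0 then E else if n = 1 then F else ∅
  have hB : ∀ n, MeasurableSet (B n) := fun n => by
    simp only [B]
    split_ifs <;> simp [hE, hF]
  have hBd : Pairwise (Function.onFun Disjoint B) := by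
    intro m n hmn
    simp only [Function.onFun, B]
    split_ifs <;> simp_all [hd.symm]
  have hU : ⋃ n, B n = E ∪ F := by
    ext x
    simp only [mem_iUnion, mem_union, B]
    constructor
    · rintro ⟨n, hn⟩
      split_ifs at hn <;> simp_all
    · rintro (h | h)
      · exact ⟨0, by simpa using h⟩
      · exact ⟨1, by simpa using h⟩
  have h := M.hasSum_iUnion B hB hBd v w
  rw [hU] at h
  have h2 : HasSum (fun n => ⟪v, M.val (B n) w⟫_ℂ) (∑ n ∈ Finset.range 2, ⟪v, M.val (B n) w⟫_ℂ) := by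
    refine hasSum_sum_of_ne_finset_zero fun n hn => ?_
    have : B n = ∅ := by
      simp only [B]
      split_ifs <;> simp_all
    simp [this, M.val_empty]
  rw [h.unique h2]
  simp [Finset.sum_range_succ, B, inner_add_right]

instance (M : POVM Ω H) (ρ : DensityOperator H) : IsProbabilityMeasure (outcomeMeasure M ρ) :=
  ⟨by simp [outcomeMeasure_apply, M.val_univ, ρ.trace_eq_one]⟩

lemma real_outcomeMeasure (M : POVM Ω H) (ρ : DensityOperator H) {E : Set Ω}
    (hE : MeasurableSet E) : (outcomeMeasure M ρ).real E = (trace (ρ.op * M.val E)).re := by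
  rw [measureReal_def, outcomeMeasure_apply M ρ hE,
    ENNReal.toReal_ofReal (trace_mul_nonneg ρ.isPositive ρ.isTraceClass (M.isPositive _ hE))]

/-- Expansion of the positive operator `(c - C)* M (c - C)` under the trace. -/
lemma re_trace_conj_sub {ρ : H →L[ℂ] H} (hρ : IsTraceClass ρ) (C M : H →L[ℂ] H) (c : ℂ) :
    (trace (ρ * (star (c • 1 - C) * M * (c • 1 - C)))).re
      = ‖c‖ ^ 2 * (trace (ρ * M)).re
        - (c.re * (trace ((ρ * star C + C * ρ) * M)).re
          + c.im * (trace ((Complex.I • (ρ * star C - C * ρ)) * M)).re)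
        + (trace (ρ * (star C * M * C))).re := by
  -- Cyclicity brings both cross terms to the form `Tr[h M]` with `h` free of `M`, so that as
  -- functions of the event they have densities given by scores.
  have hcyc : trace (C * ρ * M) = trace (ρ * M * C) := by
    rw [mul_assoc, ← trace_mul_comm (hρ.mul_right M)]
  have e : ρ * (star (c • 1 - C) * M * (c • 1 - C))
      = (star c * c) • (ρ * M) - (c • (ρ * star C * M) + star c • (ρ * M * C))
        + ρ * (star C * M * C) := by
    simp only [star_sub, star_smul, star_one, sub_mul, mul_sub, smul_mul_assoc, mul_smul_comm,
      one_mul, mul_one, smul_smul, mul_assoc, smul_sub]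
    rw [mul_comm c (star c)]
    abel
  have t1 := hρ.mul_right M
  have t2 := (hρ.mul_right (star C)).mul_right M
  have t3 := t1.mul_right C
  have t4 := hρ.mul_right (star C * M * C)
  have t5 := (hρ.mul_left C).mul_right M
  rw [e, trace_add (((t1.smul_complex _).sub ((t2.smul_complex _).add (t3.smul_complex _)))) t4,
    trace_sub (t1.smul_complex _) ((t2.smul_complex _).add (t3.smul_complex _)),
    trace_add (t2.smul_complex _) (t3.smul_complex _), add_mul, smul_mul_assoc, sub_mul,
    trace_add t2 t5, trace_smul_complex, trace_smul_complex, trace_smul_complex,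
    trace_smul_complex, trace_sub t2 t5, hcyc, ← Complex.normSq_eq_norm_sq, Complex.normSq_apply]
  simp
  ring

variable {M : POVM Ω H} {ρ₀ : DensityOperator H} {θ : parameterSpace ρ₀} {κ : Ω → XiHilbert H}

/-- The derivative of the outcome distribution in the direction `φ` is `Tr[φ M(E)]`. -/
lemma IsLogGradient.setIntegral_inner (hκ : IsLogGradient M ρ₀ θ κ) {E : Set Ω}
    (hE : MeasurableSet E) (φ : Xi H) :
    ∫ x in E, ⟪κ x, (φ : XiHilbert H)⟫_ℝ ∂outcomeMeasure M (state ρ₀ θ)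
      = (trace (φ.op * M.val E)).re := by
  obtain ⟨D, hD, hDφ⟩ := hκ.2 E hE
  rw [← hDφ]
  have ht' : IsTraceClass (family ρ₀ θ) := (state ρ₀ θ).isTraceClass
  -- Outcome probabilities are affine along the line, so the derivative supplied by the hypothesis
  -- must be the slope.
  have hval : ∀ t : ℝ, (trace (family ρ₀ (θ + t • φ) * M.val E)).re
      = (trace (family ρ₀ θ * M.val E)).re + t * (trace (φ.op * M.val E)).re := fun t => by
    rw [family_add_smul, add_mul, smul_mul_assoc,
      trace_add (ht'.mul_right _) ((φ.isTraceClass.mul_right _).smul t),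
      trace_smul, Complex.add_re, Complex.re_ofReal_mul]
  have hline : HasDerivAt (fun t : ℝ => (θ : Xi H) + t • φ) φ 0 := by
    have := ((hasDerivAt_id (0 : ℝ)).smul_const φ).const_add (θ : Xi H)
    rwa [one_smul] at this
  have h0 : (θ : Xi H) + (0 : ℝ) • φ = θ := by simp
  rw [← h0] at hD
  have h1 := hD.comp_hasDerivAt (0 : ℝ) hline
  have h2 : HasDerivAt (fun t : ℝ => (trace (family ρ₀ θ * M.val E)).re
      + t * (trace (φ.op * M.val E)).re) (trace (φ.op * M.val E)).re 0 := by
    simpa using ((hasDerivAt_id (0 : ℝ)).mul_const (trace (φ.op * M.val E)).re).const_add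
      (trace (family ρ₀ θ * M.val E)).re
  exact h1.unique (h2.congr_of_eventuallyEq (Filter.Eventually.of_forall hval))

lemma IsLogGradient.memLp_inner (hκ : IsLogGradient M ρ₀ θ κ) (a : XiHilbert H) :
    MemLp (fun x => ⟪κ x, a⟫_ℝ) 2 (outcomeMeasure M (state ρ₀ θ)) := by
  simpa only [real_inner_comm] using hκ.1.const_inner (𝕜 := ℝ) a

/-- The logarithmic gradient has mean zero. -/
lemma IsLogGradient.integral_inner_eq_zero (hκ : IsLogGradient M ρ₀ θ κ) (a : XiHilbert H) :
    ∫ x, ⟪κ x, a⟫_ℝ ∂outcomeMeasure M (state ρ₀ θ) = 0 := by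
  have hint := hκ.1.integrable (by norm_num)
  have hcomm : ∀ a : XiHilbert H, ∫ x, ⟪κ x, a⟫_ℝ ∂outcomeMeasure M (state ρ₀ θ)
      = ⟪a, ∫ x, κ x ∂outcomeMeasure M (state ρ₀ θ)⟫_ℝ := fun a => by
    rw [← integral_inner hint]
    simp only [real_inner_comm]
  rw [hcomm]
  -- On `Ξ` the mean is `Tr[φ M(Ω)] = Tr φ = 0`; density and continuity give the completion.
  refine UniformSpace.Completion.induction_on a (isClosed_eq (by fun_prop) (by fun_prop))
    fun φ => ?_
  rw [← hcomm, ← setIntegral_univ, hκ.setIntegral_inner MeasurableSet.univ, M.val_univ, mul_one,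
    φ.trace_op, Complex.zero_re]

/-- The density of `E ↦ Tr[h M(E)]` with respect to the outcome distribution. -/
noncomputable def score (ρ : DensityOperator H) (κ : Ω → XiHilbert H) (h : H →L[ℂ] H)
    (ht : IsTraceClass h) (hs : IsSelfAdjoint h) (x : Ω) : ℝ :=
  ⟪κ x, (Xi.ofCentered ρ h ht hs : XiHilbert H)⟫_ℝ + (trace h).re

variable {h : H →L[ℂ] H} (ht : IsTraceClass h) (hs : IsSelfAdjoint h)

lemma IsLogGradient.memLp_score (hκ : IsLogGradient M ρ₀ θ κ) :
    MemLp (score (state ρ₀ θ) κ h ht hs) 2 (outcomeMeasure M (state ρ₀ θ)) :=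
  (hκ.memLp_inner _).add (memLp_const _)

/-- Split `h = (h - Tr[h] ρ) + Tr[h] ρ`. The first part is a direction in `Ξ`, with density given by
`κ`; the second contributes `Tr[h] P(E)`. -/
lemma IsLogGradient.setIntegral_score (hκ : IsLogGradient M ρ₀ θ κ) {E : Set Ω}
    (hE : MeasurableSet E) :
    ∫ x in E, score (state ρ₀ θ) κ h ht hs x ∂outcomeMeasure M (state ρ₀ θ)
      = (trace (h * M.val E)).re := by
  have ht' := (state ρ₀ θ).isTraceClass
  simp only [score]
  rw [integral_add ((hκ.memLp_inner _).integrable (by norm_num)).integrableOn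
    (integrable_const _), hκ.setIntegral_inner hE, Xi.op_ofCentered, sub_mul, smul_mul_assoc,
    trace_sub (ht.mul_right _) ((ht'.mul_right _).smul _), trace_smul, setIntegral_const,
    real_outcomeMeasure _ _ hE, Complex.sub_re, Complex.re_ofReal_mul, smul_eq_mul]
  ring

/-- Pairing an unbiased estimator of the centred observable `A` with a score. -/
lemma IsLogGradient.integral_inner_mul_score (hκ : IsLogGradient M ρ₀ θ κ) {a : XiHilbert H}
    {A : H →L[ℂ] H}
    (hA : ∀ φ : Xi H, ⟪fisherOperator (outcomeMeasure M (state ρ₀ θ)) κ a, (φ : XiHilbert H)⟫_ℝ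
      = (trace (φ.op * A)).re)
    (hA0 : (trace ((state ρ₀ θ).op * A)).re = 0) :
    ∫ x, ⟪κ x, a⟫_ℝ * score (state ρ₀ θ) κ h ht hs x ∂outcomeMeasure M (state ρ₀ θ)
      = (trace (h * A)).re := by
  have ht' := (state ρ₀ θ).isTraceClass
  simp only [score, mul_add]
  have hmul : ∀ b : XiHilbert H, Integrable (fun x => ⟪κ x, a⟫_ℝ * ⟪κ x, b⟫_ℝ)
      (outcomeMeasure M (state ρ₀ θ)) := fun b =>
    (hκ.memLp_inner a).integrable_mul (hκ.memLp_inner b)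
  -- The constant part of the score drops out because `κ` has mean zero. What remains is `Re Tr[(h -
  -- Tr[h] ρ) A]`, whose `ρ` part vanishes by `hA0`.
  rw [integral_add (hmul _)
    (((hκ.memLp_inner _).integrable (by norm_num)).mul_const _), integral_mul_const,
    hκ.integral_inner_eq_zero, zero_mul, add_zero, ← inner_fisherOperator hκ.1, hA,
    Xi.op_ofCentered, sub_mul, smul_mul_assoc,
    trace_sub (ht.mul_right _) ((ht'.mul_right _).smul _), trace_smul, Complex.sub_re,
    Complex.re_ofReal_mul, hA0, mul_zero, sub_zero]

end Measurement

/-! ### The second-moment inequality and the uncertainty relation for bounded centred observables.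
-/

section ErrorBound

variable {H : Type u} [NormedAddCommGroup H] [InnerProductSpace ℂ H] [CompleteSpace H]
variable {Ω : Type*} [MeasurableSpace Ω]

/-- This operator and the one in `isSelfAdjoint_I_smul_mul_star_sub` are the partners of `c.re` and
`c.im` in `re_trace_conj_sub`; being self-adjoint, they have scores. -/
lemma isSelfAdjoint_mul_star_add {ρ : H →L[ℂ] H} (hρ : IsSelfAdjoint ρ) (C : H →L[ℂ] H) :
    IsSelfAdjoint (ρ * star C + C * ρ) := by
  rw [isSelfAdjoint_iff, star_add, star_mul, star_mul, star_star, hρ.star_eq, add_comm]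

lemma isSelfAdjoint_I_smul_mul_star_sub {ρ : H →L[ℂ] H} (hρ : IsSelfAdjoint ρ) (C : H →L[ℂ] H) :
    IsSelfAdjoint (Complex.I • (ρ * star C - C * ρ)) := by
  rw [isSelfAdjoint_iff, star_smul, star_sub, star_mul, star_mul, star_star, hρ.star_eq]
  simp only [RCLike.star_def, Complex.conj_I]
  module

/-- Positivity of `∑ᵢ Tr[ρ (sᵢ - C)* M(s = sᵢ) (sᵢ - C)]`, with `l` the density of the
cross term. -/
lemma integral_simpleFunc_add_nonneg (M : POVM Ω H) (ρ : DensityOperator H) (C : H →L[ℂ] H)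
    {l₁ l₂ : Ω → ℝ} (h₁ : Integrable l₁ (outcomeMeasure M ρ))
    (h₂ : Integrable l₂ (outcomeMeasure M ρ))
    (hl₁ : ∀ E, MeasurableSet E → ∫ x in E, l₁ x ∂outcomeMeasure M ρ
      = (trace ((ρ.op * star C + C * ρ.op) * M.val E)).re)
    (hl₂ : ∀ E, MeasurableSet E → ∫ x in E, l₂ x ∂outcomeMeasure M ρ
      = (trace ((Complex.I • (ρ.op * star C - C * ρ.op)) * M.val E)).re)
    (s : SimpleFunc Ω ℂ) :
    0 ≤ (∫ x, (‖s x‖ ^ 2 - ((s x).re * l₁ x + (s x).im * l₂ x)) ∂outcomeMeasure M ρ)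
      + (trace (ρ.op * (star C * C))).re := by
  set P := outcomeMeasure M ρ
  have hlin : ∀ c : ℂ, Integrable (fun x => c.re * l₁ x + c.im * l₂ x) P :=
    fun c => (h₁.const_mul _).add (h₂.const_mul _)
  have hconst : ∀ c : ℂ, Integrable (fun x => ‖c‖ ^ 2 - (c.re * l₁ x + c.im * l₂ x)) P :=
    fun c => (integrable_const _).sub (hlin c)
  have hfiber : ∀ c : ℂ, MeasurableSet (s ⁻¹' {c}) := s.measurableSet_fiber
  have hcongr : ∀ c : ℂ, EqOn (fun x => ‖c‖ ^ 2 - (c.re * l₁ x + c.im * l₂ x))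
      (fun x => ‖s x‖ ^ 2 - ((s x).re * l₁ x + (s x).im * l₂ x)) (s ⁻¹' {c}) := by
    intro c x hx
    have : s x = c := hx
    simp only [this]
  have hion : ∀ c : ℂ, IntegrableOn (fun x => ‖s x‖ ^ 2 - ((s x).re * l₁ x + (s x).im * l₂ x))
      (s ⁻¹' {c}) P := fun c =>
    (hconst c).integrableOn.congr_fun (hcongr c) (hfiber c)
  -- On the fibre where `s = c`, the expression is `Re Tr[ρ (c - C)* M(s = c) (c - C)]`, the trace
  -- of a state against a positive operator.
  have hcell : ∀ c : ℂ, 0 ≤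
      (∫ x in s ⁻¹' {c}, (‖s x‖ ^ 2 - ((s x).re * l₁ x + (s x).im * l₂ x)) ∂P)
        + (trace (ρ.op * (star C * M.val (s ⁻¹' {c}) * C))).re := by
    intro c
    have hpos := trace_mul_nonneg ρ.isPositive ρ.isTraceClass
      ((M.isPositive _ (hfiber c)).adjoint_conj (c • 1 - C))
    change 0 ≤ (trace (ρ.op * (star (c • 1 - C) * (M.val (s ⁻¹' {c}) * (c • 1 - C))))).re at hpos
    rw [← mul_assoc (star (c • 1 - C)), re_trace_conj_sub ρ.isTraceClass] at hpos
    rw [← setIntegral_congr_fun (hfiber c) (hcongr c),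
      integral_sub (integrable_const _) (hlin c).integrableOn,
      integral_add (h₁.const_mul _).integrableOn (h₂.const_mul _).integrableOn,
      integral_const_mul, integral_const_mul, hl₁ _ (hfiber c), hl₂ _ (hfiber c),
      setIntegral_const, real_outcomeMeasure M ρ (hfiber c), smul_eq_mul, mul_comm _ (‖c‖ ^ 2)]
    exact hpos
  -- The fibres are added up by additivity of the integral and of `M`. Over the whole range of `s`
  -- the last term becomes `Tr[ρ C* M(Ω) C]`, with `M(Ω) = 1`.
  have hsum : ∀ t : Finset ℂ,
      IntegrableOn (fun x => ‖s x‖ ^ 2 - ((s x).re * l₁ x + (s x).im * l₂ x)) (s ⁻¹' t) P ∧ 0 ≤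
      (∫ x in s ⁻¹' t, (‖s x‖ ^ 2 - ((s x).re * l₁ x + (s x).im * l₂ x)) ∂P)
        + (trace (ρ.op * (star C * M.val (s ⁻¹' t) * C))).re := by
    classical
    intro t
    induction t using Finset.induction_on with
    | empty => simp [M.val_empty, trace]
    | insert c t hc ih =>
      have ht : MeasurableSet (s ⁻¹' (t : Set ℂ)) := s.measurableSet_preimage _
      have hd : Disjoint (s ⁻¹' {c}) (s ⁻¹' (t : Set ℂ)) :=
        Disjoint.preimage _ (by simpa using hc)
      rw [Finset.coe_insert, insert_eq, preimage_union]
      refine ⟨(hion c).union ih.1, ?_⟩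
      rw [setIntegral_union hd ht (hion c) ih.1, M.val_union (hfiber c) ht hd, mul_add, add_mul,
        mul_add, trace_add (ρ.isTraceClass.mul_right _) (ρ.isTraceClass.mul_right _),
        Complex.add_re]
      linarith [hcell c, ih.2]
  have h := (hsum s.range).2
  have hu : s ⁻¹' (s.range : Set ℂ) = univ := by
    simp [SimpleFunc.coe_range]
  rwa [hu, setIntegral_univ, M.val_univ, mul_one] at h

variable {M : POVM Ω H} {ρ₀ : DensityOperator H} {θ : parameterSpace ρ₀} {κ : Ω → XiHilbert H}

/-- The second moment of a locally unbiased estimator of the centred operator `A₁ + i A₂`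
dominates the quantum second moment. -/
lemma IsLogGradient.trace_le_inner_fisherOperator (hκ : IsLogGradient M ρ₀ θ κ)
    {J : XiHilbert H →L[ℝ] XiHilbert H}
    (hJ : J = fisherOperator (outcomeMeasure M (state ρ₀ θ)) κ) {a₁ a₂ : XiHilbert H}
    {A₁ A₂ : H →L[ℂ] H} (hs₁ : IsSelfAdjoint A₁) (hs₂ : IsSelfAdjoint A₂)
    (h₁ : ∀ φ : Xi H, ⟪J a₁, (φ : XiHilbert H)⟫_ℝ = (trace (φ.op * A₁)).re)
    (h₂ : ∀ φ : Xi H, ⟪J a₂, (φ : XiHilbert H)⟫_ℝ = (trace (φ.op * A₂)).re)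
    (hz₁ : (trace (family ρ₀ θ * A₁)).re = 0) (hz₂ : (trace (family ρ₀ θ * A₂)).re = 0) :
    (trace (family ρ₀ θ * ((A₁ - Complex.I • A₂) * (A₁ + Complex.I • A₂)))).re
      ≤ ⟪J a₁, a₁⟫_ℝ + ⟪J a₂, a₂⟫_ℝ := by
  subst hJ
  set ρ := state ρ₀ θ with hρ
  have hρσ : family ρ₀ θ = ρ.op := rfl
  rw [hρσ] at hz₁ hz₂ ⊢
  set P := outcomeMeasure M ρ
  set C := A₁ + Complex.I • A₂ with hC
  have hCs : star C = A₁ - Complex.I • A₂ := by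
    rw [hC, star_add, star_smul, hs₁.star_eq, hs₂.star_eq]
    simp [sub_eq_add_neg]
  rw [← hCs]
  have ht := ρ.isTraceClass
  have hsa := ρ.isPositive.isSelfAdjoint
  have tc₁ : IsTraceClass (ρ.op * star C + C * ρ.op) := (ht.mul_right _).add (ht.mul_left _)
  have tc₂ : IsTraceClass (Complex.I • (ρ.op * star C - C * ρ.op)) :=
    ((ht.mul_right _).sub (ht.mul_left _)).smul_complex _
  have sa₁ := isSelfAdjoint_mul_star_add hsa C
  have sa₂ := isSelfAdjoint_I_smul_mul_star_sub hsa C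
  set l₁ := score ρ κ _ tc₁ sa₁
  set l₂ := score ρ κ _ tc₂ sa₂
  have ml₁ : MemLp l₁ 2 P := hκ.memLp_score tc₁ sa₁
  have ml₂ : MemLp l₂ 2 P := hκ.memLp_score tc₂ sa₂
  have mf₁ := hκ.memLp_inner a₁
  have mf₂ := hκ.memLp_inner a₂
  have hmk : ∀ {p q : Ω → ℝ}, MemLp p 2 P → MemLp q 2 P →
      MemLp (fun x => (⟨p x, q x⟩ : ℂ)) 2 P := fun {p q} hp hq => by
    have := hp.ofReal (K := ℂ) |>.add (hq.ofReal (K := ℂ) |>.const_mul Complex.I)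
    refine this.ae_eq (.of_forall fun x => ?_)
    apply Complex.ext <;> simp
  have hinner : ∀ z w : ℂ, ⟪z - w, z⟫_ℝ = ‖z‖ ^ 2 - (z.re * w.re + z.im * w.im) := fun z w => by
    rw [Complex.inner, ← Complex.normSq_eq_norm_sq, Complex.normSq_apply]
    simp
    ring
  have hmain := integral_inner_sub_add_nonneg (hmk ml₁ ml₂) (hmk mf₁ mf₂)
    (trace (ρ.op * (star C * C))).re fun s _ => by
      simp only [hinner]
      exact integral_simpleFunc_add_nonneg M ρ C (ml₁.integrable (by norm_num))
        (ml₂.integrable (by norm_num)) (fun E hE => hκ.setIntegral_score tc₁ sa₁ hE)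
        (fun E hE => hκ.setIntegral_score tc₂ sa₂ hE) s
  have hexp : ∀ x, ⟪(⟨⟪κ x, a₁⟫_ℝ, ⟪κ x, a₂⟫_ℝ⟩ : ℂ) - ⟨l₁ x, l₂ x⟩,
        (⟨⟪κ x, a₁⟫_ℝ, ⟪κ x, a₂⟫_ℝ⟩ : ℂ)⟫_ℝ
      = (⟪κ x, a₁⟫_ℝ * ⟪κ x, a₁⟫_ℝ + ⟪κ x, a₂⟫_ℝ * ⟪κ x, a₂⟫_ℝ)
        - (⟪κ x, a₁⟫_ℝ * l₁ x + ⟪κ x, a₂⟫_ℝ * l₂ x) := fun x => by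
    rw [hinner, ← Complex.normSq_eq_norm_sq, Complex.normSq_apply]
  have i₁ : Integrable (fun x => ⟪κ x, a₁⟫_ℝ * ⟪κ x, a₁⟫_ℝ) P := mf₁.integrable_mul mf₁
  have i₂ : Integrable (fun x => ⟪κ x, a₂⟫_ℝ * ⟪κ x, a₂⟫_ℝ) P := mf₂.integrable_mul mf₂
  have i₃ : Integrable (fun x => ⟪κ x, a₁⟫_ℝ * l₁ x) P := mf₁.integrable_mul ml₁
  have i₄ : Integrable (fun x => ⟪κ x, a₂⟫_ℝ * l₂ x) P := mf₂.integrable_mul ml₂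
  have i₅ : Integrable (fun x => ⟪κ x, a₁⟫_ℝ * ⟪κ x, a₁⟫_ℝ + ⟪κ x, a₂⟫_ℝ * ⟪κ x, a₂⟫_ℝ) P :=
    i₁.add i₂
  have i₆ : Integrable (fun x => ⟪κ x, a₁⟫_ℝ * l₁ x + ⟪κ x, a₂⟫_ℝ * l₂ x) P := i₃.add i₄
  simp only [hexp] at hmain
  rw [integral_sub i₅ i₆, integral_add i₁ i₂, integral_add i₃ i₄,
    ← inner_fisherOperator hκ.1, ← inner_fisherOperator hκ.1,
    hκ.integral_inner_mul_score tc₁ sa₁ h₁ hz₁, hκ.integral_inner_mul_score tc₂ sa₂ h₂ hz₂]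
    at hmain
  have hcyc : ∀ X : H →L[ℂ] H, trace (C * ρ.op * X) = trace (ρ.op * X * C) := fun X => by
    rw [mul_assoc, ← trace_mul_comm (ht.mul_right X)]
  -- The cross term equals `2 Tr[ρ C* C]`: the `ρ C*` parts combine `A₁ + i A₂` into `C` on the
  -- right, and after a cyclic shift the `C ρ` parts combine `A₁ - i A₂` into `C*`. One of the two
  -- copies cancels the last term of the expansion.
  have htr : trace ((ρ.op * star C + C * ρ.op) * A₁)
      + trace ((Complex.I • (ρ.op * star C - C * ρ.op)) * A₂)
      = 2 * trace (ρ.op * (star C * C)) := by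
    have tA : ∀ X, IsTraceClass (ρ.op * star C * X) := fun X => (ht.mul_right _).mul_right X
    have tB : ∀ X, IsTraceClass (C * ρ.op * X) := fun X => (ht.mul_left _).mul_right X
    have tD : ∀ X Y, IsTraceClass (ρ.op * X * Y) := fun X Y => (ht.mul_right _).mul_right Y
    have e₁ : ρ.op * (star C * C) = ρ.op * star C * A₁ + Complex.I • (ρ.op * star C * A₂) := by
      rw [← mul_assoc, hC, mul_add, mul_smul_comm]
    have e₂ : ρ.op * (star C * C) = ρ.op * A₁ * C - Complex.I • (ρ.op * A₂ * C) := by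
      rw [← mul_assoc, hCs, mul_sub, sub_mul, mul_smul_comm, smul_mul_assoc]
    have f₁ := congrArg trace e₁
    have f₂ := congrArg trace e₂
    rw [trace_add (tA _) ((tA _).smul_complex _), trace_smul_complex] at f₁
    rw [trace_sub (tD _ _) ((tD _ _).smul_complex _), trace_smul_complex] at f₂
    rw [add_mul, smul_mul_assoc, sub_mul, trace_add (tA _) (tB _), trace_smul_complex,
      trace_sub (tA _) (tB _), hcyc, hcyc]
    linear_combination -f₁ - f₂
  have htr' := congrArg Complex.re htr
  simp only [Complex.add_re, Complex.mul_re, Complex.re_ofNat, Complex.im_ofNat, zero_mul,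
    sub_zero] at htr'
  linarith

/-- The uncertainty relation for bounded centred observables. -/
lemma IsLogGradient.sq_add_sq_le (hκ : IsLogGradient M ρ₀ θ κ)
    {J : XiHilbert H →L[ℝ] XiHilbert H}
    (hJ : J = fisherOperator (outcomeMeasure M (state ρ₀ θ)) κ) {a b : XiHilbert H}
    {A B : H →L[ℂ] H} (hsA : IsSelfAdjoint A) (hsB : IsSelfAdjoint B)
    (hA : ∀ φ : Xi H, ⟪J a, (φ : XiHilbert H)⟫_ℝ = (trace (φ.op * A)).re)
    (hB : ∀ φ : Xi H, ⟪J b, (φ : XiHilbert H)⟫_ℝ = (trace (φ.op * B)).re)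
    (hzA : (trace (family ρ₀ θ * A)).re = 0) (hzB : (trace (family ρ₀ θ * B)).re = 0) :
    (⟪J a, b⟫_ℝ - (trace (family ρ₀ θ * (A * B))).re) ^ 2
        + (trace (family ρ₀ θ * (A * B))).im ^ 2
      ≤ (⟪J a, a⟫_ℝ - (trace (family ρ₀ θ * (A * A))).re)
        * (⟪J b, b⟫_ℝ - (trace (family ρ₀ θ * (B * B))).re) := by
  set σ := family ρ₀ θ with hσ
  have ht : IsTraceClass σ := (state ρ₀ θ).isTraceClass
  have hσa : IsSelfAdjoint σ := (state ρ₀ θ).isPositive.isSelfAdjoint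
  have hJsym : ⟪J b, a⟫_ℝ = ⟪J a, b⟫_ℝ := by
    rw [hJ, inner_fisherOperator hκ.1, inner_fisherOperator hκ.1]
    simp only [mul_comm]
  have hBA : trace (σ * (B * A)) = star (trace (σ * (A * B))) := by
    rw [← trace_star, star_mul, star_mul, hsA.star_eq, hsB.star_eq, hσa.star_eq,
      trace_mul_comm ht]
  have hlin : ∀ (X Y : H →L[ℂ] H) (p q : ℝ) (τ : H →L[ℂ] H), IsTraceClass τ →
      trace (τ * (p • X + q • Y)) = p * trace (τ * X) + q * trace (τ * Y) := by
    intro X Y p q τ hτ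
    rw [mul_add, mul_smul_comm, mul_smul_comm,
      trace_add ((hτ.mul_right _).smul _) ((hτ.mul_right _).smul _), trace_smul, trace_smul]
  -- The second-moment inequality for `C = p A + (q - i r) B`. The complex coefficient of `B` brings
  -- in `Im Tr[σ A B]`, that is, the commutator.
  have key : ∀ p q r : ℝ, 0 ≤ p ^ 2 * (⟪J a, a⟫_ℝ - (trace (σ * (A * A))).re)
      + (q ^ 2 + r ^ 2) * (⟪J b, b⟫_ℝ - (trace (σ * (B * B))).re)
      + 2 * p * (q * (⟪J a, b⟫_ℝ - (trace (σ * (A * B))).re) - r * (trace (σ * (A * B))).im) := by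
    intro p q r
    have h := hκ.trace_le_inner_fisherOperator hJ (a₁ := p • a + q • b) (a₂ := (-r) • b)
      (A₁ := p • A + q • B) (A₂ := (-r) • B)
      (((IsSelfAdjoint.all p).smul hsA).add ((IsSelfAdjoint.all q).smul hsB))
      ((IsSelfAdjoint.all (-r)).smul hsB)
      (fun φ => by
        rw [hlin _ _ _ _ _ φ.isTraceClass, map_add, map_smul, map_smul, inner_add_left,
          real_inner_smul_left, real_inner_smul_left, hA, hB, Complex.add_re,
          Complex.re_ofReal_mul, Complex.re_ofReal_mul])
      (fun φ => by
        rw [mul_smul_comm, trace_smul, map_smul, real_inner_smul_left, hB,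
          Complex.re_ofReal_mul])
      (by
        rw [hlin _ _ _ _ _ ht, Complex.add_re, Complex.re_ofReal_mul, Complex.re_ofReal_mul, hzA,
          hzB, mul_zero, mul_zero, add_zero])
      (by rw [mul_smul_comm, trace_smul, Complex.re_ofReal_mul, hzB, mul_zero])
    have e : (p • A + q • B - Complex.I • (-r) • B) * (p • A + q • B + Complex.I • (-r) • B)
        = ((p : ℂ) * p) • (A * A) + ((p : ℂ) * (q - Complex.I * r)) • (A * B)
          + ((p : ℂ) * (q + Complex.I * r)) • (B * A)
          + ((q + Complex.I * r) * (q - Complex.I * r)) • (B * B) := by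
      have e₁ : p • A + q • B - Complex.I • (-r) • B
          = (p : ℂ) • A + ((q : ℂ) + Complex.I * r) • B := by
        rw [← Complex.coe_smul, ← Complex.coe_smul, ← Complex.coe_smul]
        push_cast
        module
      have e₂ : p • A + q • B + Complex.I • (-r) • B
          = (p : ℂ) • A + ((q : ℂ) - Complex.I * r) • B := by
        rw [← Complex.coe_smul, ← Complex.coe_smul, ← Complex.coe_smul]
        push_cast
        module
      rw [e₁, e₂, add_mul, mul_add, mul_add]
      simp only [smul_mul_smul_comm]
      rw [mul_comm ((q : ℂ) + Complex.I * r) (p : ℂ)]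
      abel
    have tX : ∀ (c : ℂ) (X : H →L[ℂ] H), IsTraceClass (c • (σ * X)) := fun c X =>
      (ht.mul_right X).smul_complex c
    rw [e, mul_add, mul_add, mul_add] at h
    simp only [mul_smul_comm] at h
    rw [trace_add (((tX _ _).add (tX _ _)).add (tX _ _)) (tX _ _),
      trace_add ((tX _ _).add (tX _ _)) (tX _ _), trace_add (tX _ _) (tX _ _)] at h
    simp only [trace_smul_complex, hBA, map_add, map_smul, inner_add_left, inner_add_right,
      real_inner_smul_left, real_inner_smul_right, hJsym] at h
    simp at h
    nlinarith [h]
  set α := ⟪J a, a⟫_ℝ - (trace (σ * (A * A))).re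
  set β := ⟪J b, b⟫_ℝ - (trace (σ * (B * B))).re
  set x := ⟪J a, b⟫_ℝ - (trace (σ * (A * B))).re
  set y := (trace (σ * (A * B))).im
  have hα : 0 ≤ α := by simpa using key 1 0 0
  have hβ : 0 ≤ β := by simpa using key 0 1 0
  -- The coefficient of `B` is aligned with the off-diagonal entry (`q = x`, `r = -y`), so the cross
  -- term becomes `2 t (x² + y²)`, and the quadratic in `t` has nonpositive discriminant.
  have hdisc := discrim_le_zero (a := α) (b := 2 * (x ^ 2 + y ^ 2)) (c := (x ^ 2 + y ^ 2) * β)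
    fun t => by
      have := key t x (-y)
      linarith
  rw [discrim] at hdisc
  -- The discriminant inequality carries an extra factor `x² + y²`; if it vanishes, `α, β ≥ 0`
  -- suffices.
  rcases (by positivity : 0 ≤ x ^ 2 + y ^ 2).eq_or_lt with h0 | h0
  · rw [← h0]
    positivity
  · nlinarith

end ErrorBound

/-! ### Subtracting mean values. -/

section Centering

variable {H : Type u} [NormedAddCommGroup H] [InnerProductSpace ℂ H] [CompleteSpace H]

lemma im_trace_mul_eq_zero {ρ A : H →L[ℂ] H} (hρt : IsTraceClass ρ) (hρ : IsSelfAdjoint ρ)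
    (hA : IsSelfAdjoint A) : (trace (ρ * A)).im = 0 := by
  have h := trace_star (ρ * A)
  rw [star_mul, hρ.star_eq, hA.star_eq, ← trace_mul_comm hρt] at h
  exact Complex.conj_eq_iff_im.mp h.symm

/-- Identifies the second moments of the centred operators with the correlations in the statement of
the theorem. -/
lemma trace_mul_sub_mul_sub {ρ : H →L[ℂ] H} (hρ : IsTraceClass ρ) (h1 : trace ρ = 1)
    (A B : H →L[ℂ] H) {x y : ℝ} (hx : trace (ρ * A) = x) (hy : trace (ρ * B) = y) :
    trace (ρ * ((A - x • 1) * (B - y • 1))) = trace (ρ * (A * B)) - x * y := by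
  have e : ρ * ((A - x • 1) * (B - y • 1))
      = ρ * (A * B) - y • (ρ * A) - (x • (ρ * B) - (x * y) • ρ) := by
    simp only [sub_mul, mul_sub, smul_mul_assoc, mul_smul_comm, one_mul, mul_one]
    module
  have t1 := hρ.mul_right (A * B)
  have t2 := (hρ.mul_right A).smul y
  have t3 := (hρ.mul_right B).smul x
  have t4 := hρ.smul (x * y)
  rw [e, trace_sub (t1.sub t2) (t3.sub t4), trace_sub t1 t2, trace_sub t3 t4, trace_smul,
    trace_smul, trace_smul, hx, hy, h1]
  push_cast
  ring

end Centering

end QuantumEstimation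

/-! ### Reduction of the theorem to bounded centred observables. -/

theorem mainTheorem2 {H : Type*} [NormedAddCommGroup H] [InnerProductSpace ℂ H] [CompleteSpace H]
    [TopologicalSpace.SeparableSpace H] {Ω : Type*} [MeasurableSpace Ω]
    (ρ₀ : DensityOperator H) (θ : parameterSpace ρ₀)
    (M : POVM Ω H)
    (κ : Ω → XiHilbert H) (hκ : IsLogGradient M ρ₀ θ κ)
    (J : XiHilbert H →L[ℝ] XiHilbert H)
    (hJ : J = fisherOperator
      (outcomeMeasure M (state ρ₀ θ)) κ)
    (S : XiHilbert H →ₗ.[ℝ] XiHilbert H)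
    (hS : IsMoorePenroseInverse J S)
    (σ : H →L[ℂ] H) (hσ : σ = family ρ₀ θ)
    (A B : H →ₗ.[ℂ] H)
    (hA : A ∈ observables σ) (hB : B ∈ observables σ)
    (hAA : opMul A A ∈ finiteExpectation σ)
    (hBB : opMul B B ∈ finiteExpectation σ)
    (hAB : opMul A B ∈ finiteExpectation σ)
    (gA gB : S.domain)
    (hgA : IsExpectationGradient ρ₀ θ A gA)
    (hgB : IsExpectationGradient ρ₀ θ B gB) :
    ((residualCorrelation σ A B S gA gB ^ 2
        + 1 / 4 * ‖expectation σ (opCommutator A B)‖ ^ 2 : ℝ) :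
          EReal) ≤
      errorMul (measurementError σ A J S gA)
        (measurementError σ B J S gB) := by
  by_cases hkA : (gA : XiHilbert H) ∈ (LinearMap.ker J.toLinearMap)ᗮ
  swap
  · simp [errorMul, measurementError, hkA]
  by_cases hkB : (gB : XiHilbert H) ∈ (LinearMap.ker J.toLinearMap)ᗮ
  swap
  · simp [errorMul, measurementError, hkB]
  rw [measurementError, measurementError, if_pos hkA, if_pos hkB, errorMul,
    if_neg (not_or.mpr ⟨EReal.coe_ne_top _, EReal.coe_ne_top _⟩), ← EReal.coe_mul, EReal.coe_le_coe_iff]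
  subst hσ
  obtain ⟨X, hXs, rfl, hX⟩ := hgA.exists_bounded hA
  obtain ⟨Y, hYs, rfl, hY⟩ := hgB.exists_bounded hB
  set σ := family ρ₀ θ with hσ
  have ht : IsTraceClass σ := (state ρ₀ θ).isTraceClass
  have hsa : IsSelfAdjoint σ := (state ρ₀ θ).isPositive.isSelfAdjoint
  have h1 : trace σ = 1 := (state ρ₀ θ).trace_eq_one
  have hJs : ∀ x y, ⟪J x, y⟫_ℝ = ⟪x, J y⟫_ℝ := fun x y => by
    rw [real_inner_comm (J y), hJ, inner_fisherOperator hκ.1, inner_fisherOperator hκ.1]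
    simp only [mul_comm]
  have hJA := hS.apply_apply hJs gA hkA
  have hJB := hS.apply_apply hJs gB hkB
  obtain ⟨x, hx⟩ : ∃ x : ℝ, trace (σ * X) = x :=
    ⟨_, (Complex.ext rfl (by simp [im_trace_mul_eq_zero ht hsa hXs]) :
      trace (σ * X) = ((trace (σ * X)).re : ℂ))⟩
  obtain ⟨y, hy⟩ : ∃ y : ℝ, trace (σ * Y) = y :=
    ⟨_, (Complex.ext rfl (by simp [im_trace_mul_eq_zero ht hsa hYs]) :
      trace (σ * Y) = ((trace (σ * Y)).re : ℂ))⟩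
  have hcen : ∀ {Z : H →L[ℂ] H} {z : ℝ}, trace (σ * Z) = z → (trace (σ * (Z - z • 1))).re = 0 := by
    intro Z z hz
    rw [mul_sub, mul_smul_comm, mul_one, trace_sub (ht.mul_right _) (ht.smul _), trace_smul, h1,
      hz]
    simp
  -- Directions in `Ξ` have trace zero, so centring does not change the gradient.
  have hgrad : ∀ (Z : H →L[ℂ] H) (z : ℝ) (φ : Xi H),
      (trace (φ.op * (Z - z • 1))).re = (trace (φ.op * Z)).re := by
    intro Z z φ
    rw [mul_sub, mul_smul_comm, mul_one, trace_sub (φ.isTraceClass.mul_right _)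
      (φ.isTraceClass.smul _), trace_smul, φ.trace_op, mul_zero, sub_zero]
  have hone : ∀ z : ℝ, IsSelfAdjoint (z • (1 : H →L[ℂ] H)) := fun z =>
    (IsSelfAdjoint.all z).smul (IsSelfAdjoint.one _)
  have hmain := hκ.sq_add_sq_le hJ (a := S gA) (b := S gB) (hXs.sub (hone x)) (hYs.sub (hone y))
    (fun φ => by rw [hJA, hX, hgrad]) (fun φ => by rw [hJB, hY, hgrad]) (hcen hx) (hcen hy)
  rw [hJA, hJB, ← hσ, trace_mul_sub_mul_sub ht h1 X Y hx hy, trace_mul_sub_mul_sub ht h1 X X hx hx,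
    trace_mul_sub_mul_sub ht h1 Y Y hy hy] at hmain
  have hYX : trace (σ * (Y * X)) = star (trace (σ * (X * Y))) := by
    rw [← trace_star, star_mul, star_mul, hXs.star_eq, hYs.star_eq, hsa.star_eq,
      trace_mul_comm ht]
  -- `Tr[σ Y X]` is the conjugate of `Tr[σ X Y]`, so the commutator has expectation `2 i Im Tr[σ X
  -- Y]`; the factor `1/4` in the theorem cancels the 4.
  have hcomm : ‖expectation σ (opCommutator ((X : H →ₗ[ℂ] H).toPMap ⊤)
      ((Y : H →ₗ[ℂ] H).toPMap ⊤))‖ ^ 2 = 4 * (trace (σ * (X * Y))).im ^ 2 := by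
    rw [opCommutator_toPMap, expectation_toPMap ht, mul_sub,
      trace_sub (ht.mul_right _) (ht.mul_right _), hYX, ← Complex.normSq_eq_norm_sq,
      Complex.normSq_apply]
    simp
    ring
  rw [hcomm, residualCorrelation, symCorrelation, variance, variance, correlation, correlation,
    correlation, correlation, opMul_toPMap, opMul_toPMap, opMul_toPMap, opMul_toPMap,
    expectation_toPMap ht, expectation_toPMap ht, expectation_toPMap ht, expectation_toPMap ht,
    expectation_toPMap ht, expectation_toPMap ht, hx, hy, hYX]
  simp at hmain ⊢
  convert hmain using 1
  ring
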